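/- For $j>0$ and $\kappa\ge 0$ let $\mathcal L^R(j,\kappa)=-\frac{d^2}{dx^2}+i\,j\,x$ be the Robin realization of the complex Airy operator in $L^2(\mathbb R_+;\mathbb C)$, with domain $$D(\mathcal L^R(j,\kappa))=\{u\in H^2(\mathbb R_+;\mathbb C)\cap L^2(\mathbb R_+;x^2dx)\;:\;u'(0)=\kappa\,u(0)\}.$$ Fix $\kappa\ge 0$. For every $j>0$ the eigenvalues of $\mathcal L^R(j,\kappa)$ form an infinite sequence $(\lambda_n^R(j,\kappa))_{n\ge1}$ of pairwise distinct numbers, which is uniquely determined by the requirement that the real parts be nondecreasing in $n$. For every $n\ge 1$, $\lambda_n^R(j,\kappa)\to 0$ as $j\to 0^+$, and with the convention $\lambda_n^R(0,\kappa):=0$ (extension by continuity) the map $j\mapsto \operatorname{Re}\lambda_n^R(j,\kappa)$ is strictly increasing on $[0,+\infty)$. -/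

import Mathlib

open MeasureTheory Set Filter Topology

noncomputable section

namespace RobinAiry

/-- Lebesgue measure on the half-line `(0, ∞)`. -/
abbrev halfLine : Measure ℝ := volume.restrict (Ioi (0 : ℝ))

/-- The Hilbert space `L²(ℝ₊; ℂ)`. -/
abbrev L2 : Type := Lp ℂ 2 halfLine

/-- `u` is (the continuous representative of) an element of the Sobolev space `H²(ℝ₊; ℂ)`, with
first derivative `u₁` and second derivative `u₂`: the functions `u`, `u₁` are locally absolutely
continuous on `[0, ∞)`, with `u' = u₁` and `u₁' = u₂` there, and `u, u₁, u₂ ∈ L²(ℝ₊)`.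
In particular the boundary values are `u(0) = u 0` and `u'(0) = u₁ 0`. Values on the negative
half-line play no role. -/
structure IsH2 (u u₁ u₂ : ℝ → ℂ) : Prop where
  memLp : MemLp u 2 halfLine
  memLp_one : MemLp u₁ 2 halfLine
  memLp_two : MemLp u₂ 2 halfLine
  eq_integral : ∀ x, 0 ≤ x → u x = u 0 + ∫ t in (0 : ℝ)..x, u₁ t
  one_eq_integral : ∀ x, 0 ≤ x → u₁ x = u₁ 0 + ∫ t in (0 : ℝ)..x, u₂ t

theorem intervalIntegrable_of_memLp {g : ℝ → ℂ} (hg : MemLp g 2 halfLine) {x : ℝ} (hx : 0 ≤ x) :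
    IntervalIntegrable g volume 0 x := by
  rw [intervalIntegrable_iff_integrableOn_Ioc_of_le hx]
  have h : MemLp g 2 (volume.restrict (Ioc 0 x)) :=
    hg.mono_measure (Measure.restrict_mono (fun _ h => h.1) le_rfl)
  exact h.integrable (by norm_num)

theorem IsH2.zero : IsH2 0 0 0 := by
  constructor <;> simp

theorem IsH2.add {u u₁ u₂ v v₁ v₂ : ℝ → ℂ} (hu : IsH2 u u₁ u₂) (hv : IsH2 v v₁ v₂) :
    IsH2 (u + v) (u₁ + v₁) (u₂ + v₂) where
  memLp := hu.memLp.add hv.memLp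
  memLp_one := hu.memLp_one.add hv.memLp_one
  memLp_two := hu.memLp_two.add hv.memLp_two
  eq_integral x hx := by
    simp only [Pi.add_apply]
    rw [intervalIntegral.integral_add (intervalIntegrable_of_memLp hu.memLp_one hx)
      (intervalIntegrable_of_memLp hv.memLp_one hx), hu.eq_integral x hx, hv.eq_integral x hx]
    ring
  one_eq_integral x hx := by
    simp only [Pi.add_apply]
    rw [intervalIntegral.integral_add (intervalIntegrable_of_memLp hu.memLp_two hx)
      (intervalIntegrable_of_memLp hv.memLp_two hx), hu.one_eq_integral x hx,
      hv.one_eq_integral x hx]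
    ring

theorem IsH2.smul {u u₁ u₂ : ℝ → ℂ} (c : ℂ) (hu : IsH2 u u₁ u₂) :
    IsH2 (c • u) (c • u₁) (c • u₂) where
  memLp := hu.memLp.const_smul c
  memLp_one := hu.memLp_one.const_smul c
  memLp_two := hu.memLp_two.const_smul c
  eq_integral x hx := by
    simp only [Pi.smul_apply]
    rw [intervalIntegral.integral_smul, hu.eq_integral x hx, smul_add]
  one_eq_integral x hx := by
    simp only [Pi.smul_apply]
    rw [intervalIntegral.integral_smul, hu.one_eq_integral x hx, smul_add]

/-- If a primitive on `[0, ∞)` vanishes almost everywhere, it vanishes everywhere on `[0, ∞)`,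
and so does its integrand, almost everywhere. -/
theorem primitive_eq_zero {u g : ℝ → ℂ} (hg : MemLp g 2 halfLine)
    (h : ∀ x, 0 ≤ x → u x = u 0 + ∫ t in (0 : ℝ)..x, g t) (h0 : u =ᵐ[halfLine] 0) :
    (∀ x, 0 ≤ x → u x = 0) ∧ g =ᵐ[halfLine] 0 := by
  set G : ℝ → ℂ := fun x => u 0 + ∫ t in (0 : ℝ)..x, (Ioi (0 : ℝ)).indicator g t with hG
  have hint : ∀ a b : ℝ, IntervalIntegrable ((Ioi (0 : ℝ)).indicator g) volume a b := by
    intro a b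
    have h1 : MemLp ((Ioi (0 : ℝ)).indicator g) 2 volume :=
      (memLp_indicator_iff_restrict measurableSet_Ioi).2 hg
    exact ((h1.locallyIntegrable (by norm_num)).integrableOn_isCompact
      isCompact_uIcc).intervalIntegrable
  have hcont : Continuous G :=
    continuous_const.add (intervalIntegral.continuous_primitive hint 0)
  have huG : ∀ x, 0 ≤ x → u x = G x := by
    intro x hx
    rw [h x hx, hG]
    congr 1
    refine intervalIntegral.integral_congr_ae (ae_of_all _ fun t ht => ?_)
    rw [uIoc_of_le hx] at ht
    rw [indicator_of_mem (show t ∈ Ioi (0 : ℝ) from ht.1)]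
  have hG0 : ∀ x ∈ Ioi (0 : ℝ), G x = 0 := by
    have hae : G =ᵐ[volume.restrict (Ioi (0 : ℝ))] fun _ => (0 : ℂ) := by
      filter_upwards [h0, ae_restrict_mem measurableSet_Ioi] with x hx hx'
      rw [← huG x (le_of_lt hx'), hx]; rfl
    exact Measure.eqOn_open_of_ae_eq hae isOpen_Ioi hcont.continuousOn continuousOn_const
  have hG0' : ∀ x, 0 ≤ x → G x = 0 := by
    intro x hx
    have hcl : x ∈ closure (Ioi (0 : ℝ)) := by rw [closure_Ioi]; exact hx
    exact closure_minimal (t := {y | G y = 0}) hG0 (isClosed_eq hcont continuous_const) hcl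
  refine ⟨fun x hx => (huG x hx).trans (hG0' x hx), ?_⟩
  have hderiv : ∀ᵐ x, HasDerivAt (fun x => ∫ t in (0 : ℝ)..x, (Ioi (0 : ℝ)).indicator g t)
      ((Ioi (0 : ℝ)).indicator g x) x := by
    have h1 : MemLp ((Ioi (0 : ℝ)).indicator g) 2 volume :=
      (memLp_indicator_iff_restrict measurableSet_Ioi).2 hg
    filter_upwards [LocallyIntegrable.ae_hasDerivAt_integral
      (h1.locallyIntegrable (by norm_num))] with x hx
    exact hx 0
  filter_upwards [ae_restrict_of_ae hderiv, ae_restrict_mem measurableSet_Ioi] with x hx hx'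
  have h1 : HasDerivAt G ((Ioi (0 : ℝ)).indicator g x) x := hx.const_add _
  have h2 : HasDerivAt G 0 x := by
    refine (hasDerivAt_const x (0 : ℂ)).congr_of_eventuallyEq ?_
    filter_upwards [isOpen_Ioi.mem_nhds hx'] with y hy using hG0 y hy
  have h3 := h1.unique h2
  rwa [indicator_of_mem hx'] at h3

/-- The graph of the Robin realization of `-d²/dx² + i j x` on `ℝ₊`: the pairs
`(u, -u'' + i j x u)` in `L²(ℝ₊) × L²(ℝ₊)` where `u ∈ H²(ℝ₊) ∩ L²(ℝ₊; x² dx)` satisfies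
`u'(0) = κ u(0)`. -/
def graph (j κ : ℝ) : Submodule ℂ (L2 × L2) where
  carrier := {p | ∃ u u₁ u₂ : ℝ → ℂ, IsH2 u u₁ u₂ ∧ MemLp (fun x : ℝ => (x : ℂ) * u x) 2 halfLine ∧
    u₁ 0 = κ * u 0 ∧ p.1 =ᵐ[halfLine] u ∧
    p.2 =ᵐ[halfLine] fun x : ℝ => -u₂ x + Complex.I * j * x * u x}
  zero_mem' := by
    refine ⟨0, 0, 0, IsH2.zero, by simp, by simp, ?_, ?_⟩
    · exact Lp.coeFn_zero ℂ 2 halfLine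
    · filter_upwards [Lp.coeFn_zero ℂ 2 halfLine] with x h
      simpa using h
  add_mem' := by
    rintro ⟨p, q⟩ ⟨p', q'⟩ ⟨u, u₁, u₂, hu, hxu, hbu, hp, hq⟩ ⟨v, v₁, v₂, hv, hxv, hbv, hp', hq'⟩
    refine ⟨u + v, u₁ + v₁, u₂ + v₂, hu.add hv, ?_, ?_, ?_, ?_⟩
    · have : (fun x : ℝ => (x : ℂ) * (u + v) x) =
          (fun x : ℝ => (x : ℂ) * u x) + fun x : ℝ => (x : ℂ) * v x := by
        ext x; simp only [Pi.add_apply]; ring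
      rw [this]; exact hxu.add hxv
    · simp only [Pi.add_apply, hbu, hbv]; ring
    · exact (Lp.coeFn_add p p').trans (hp.add hp')
    · filter_upwards [Lp.coeFn_add q q', hq, hq'] with x h1 h2 h3
      simp only [Prod.mk_add_mk] at h2 h3 ⊢
      rw [h1, Pi.add_apply, h2, h3]
      simp only [Pi.add_apply]; ring
  smul_mem' := by
    rintro c ⟨p, q⟩ ⟨u, u₁, u₂, hu, hxu, hbu, hp, hq⟩
    refine ⟨c • u, c • u₁, c • u₂, hu.smul c, ?_, ?_, ?_, ?_⟩
    · have : (fun x : ℝ => (x : ℂ) * (c • u) x) = c • fun x : ℝ => (x : ℂ) * u x := by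
        ext x; simp only [Pi.smul_apply, smul_eq_mul]; ring
      rw [this]; exact hxu.const_smul c
    · simp only [Pi.smul_apply, smul_eq_mul, hbu]; ring
    · exact (Lp.coeFn_smul c p).trans (hp.const_smul c)
    · filter_upwards [Lp.coeFn_smul c q, hq] with x h1 h2
      simp only [Prod.smul_mk] at h2 ⊢
      rw [h1, Pi.smul_apply, h2]
      simp only [Pi.smul_apply, smul_eq_mul]; ring

theorem graph_single_valued (j κ : ℝ) (p : L2 × L2) (hp : p ∈ graph j κ) (h0 : p.1 = 0) :
    p.2 = 0 := by
  obtain ⟨u, u₁, u₂, hu, -, -, h1, h2⟩ := hp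
  have hu0 : u =ᵐ[halfLine] 0 := by
    rw [h0] at h1
    exact h1.symm.trans (Lp.coeFn_zero ℂ 2 halfLine)
  obtain ⟨-, hu1⟩ := primitive_eq_zero hu.memLp_one hu.eq_integral hu0
  obtain ⟨-, hu2⟩ := primitive_eq_zero hu.memLp_two hu.one_eq_integral hu1
  refine Lp.ext (h2.trans ?_)
  filter_upwards [hu0, hu2, Lp.coeFn_zero ℂ 2 halfLine] with x a b c
  rw [a, b, c]; simp

/-- The Robin realization `𝓛ᴿ(j, κ)` of the complex Airy operator `-d²/dx² + i j x` on the
half-line, an unbounded operator in `L²(ℝ₊; ℂ)` with domain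
`{u ∈ H²(ℝ₊) ∩ L²(ℝ₊; x² dx) | u'(0) = κ u(0)}`. -/
def robinAiry (j κ : ℝ) : L2 →ₗ.[ℂ] L2 := (graph j κ).toLinearPMap

theorem robinAiry_graph (j κ : ℝ) : (robinAiry j κ).graph = graph j κ :=
  Submodule.toLinearPMap_graph_eq _ (graph_single_valued j κ)

/-- `z` is an eigenvalue of the unbounded operator `T`. -/
def IsEigenvalue (T : L2 →ₗ.[ℂ] L2) (z : ℂ) : Prop :=
  ∃ v : T.domain, (v : L2) ≠ 0 ∧ T v = z • (v : L2)

/-- `lam` is the sequence of eigenvalues of `T` ordered by nondecreasing real part: it lists every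
eigenvalue exactly once, and nothing else. Indices start at `0`, so `lam n` is the eigenvalue of
number `n + 1`. -/
structure IsEigenvalueSequence (T : L2 →ₗ.[ℂ] L2) (lam : ℕ → ℂ) : Prop where
  injective : Function.Injective lam
  range_eq : Set.range lam = {z | IsEigenvalue T z}
  re_monotone : Monotone fun n => (lam n).re

end RobinAiry

end

/-! The decaying solutions of `-u'' + i j x u = λ u` are Airy functions along a ray. With `j = τ³`,
`λ = τ² z` and `s = κ/τ`, the eigenvalue condition becomes a secular equation for `z` involving `s`
alone (`isEigenvalue_robinAiry_iff`), so one family of curves `μ_n(s)`, `s ≥ 0`, governs all `j`.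

Differentiating the secular equation gives `μ' = i/(μ + s²)`. Along this flow the secular function
solves a linear homogeneous equation (`hasDerivAt_secular`), so zeros are carried to zeros in both
directions. At `s = 0` (Neumann) they are `r_n e^{iπ/3}`, where the `-r_n` are the zeros of `Ai'`:
real, at most `-19/20`, locally finite and unbounded. An energy estimate
(`le_re_of_secular_eq_zero`) keeps a curve followed backwards under control, so every zero
originates at `s = 0` (`exists_isFlow_of_secular_eq_zero`).

The difference of two curves is `(r_m - r_n) e^{iπ/3}` times an exponential whose phase stays in
`(-5π/6, π/6)`, so real parts never cross (`IsFlow.re_sub_pos`); this makes the ordering strict and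
hence unique. Finally `λ_n = τ² μ_n(κ/τ)`. Linear growth of `μ_n` gives the limit `0`, and the
`τ`-derivative of the real part is `τ (2 Re μ - s Im μ / |μ + s²|²)`, which is positive because the
subtracted quotient is at most `1/2` while `Re μ ≥ 19/40` (`strictMonoOn_sq_mul_curve`). -/

namespace RobinAiry

open Complex ComplexConjugate

/-! ### The Airy function as a contour integral -/

/-- The integrand of the Airy integral on the horizontal line `Im ζ = η`. -/
noncomputable def airyKernel (η : ℝ) (z : ℂ) (t : ℝ) : ℂ :=
  exp (I * ((t + η * I) ^ 3 / 3 + z * (t + η * I)))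

theorem norm_airyKernel (η : ℝ) (z : ℂ) (t : ℝ) :
    ‖airyKernel η z t‖ = Real.exp (-η * t ^ 2 + η ^ 3 / 3 - η * z.re - t * z.im) := by
  rw [airyKernel, norm_exp]
  congr 1
  have h3 : ((t : ℂ) + η * I) ^ 3 / 3 =
      ((t ^ 3 / 3 - t * η ^ 2 : ℝ) : ℂ) + ((t ^ 2 * η - η ^ 3 / 3 : ℝ) : ℂ) * I := by
    push_cast
    linear_combination (t * η ^ 2 + η ^ 3 * I / 3) * I_sq
  rw [h3, I_mul_re]
  simp only [add_im, mul_im, ofReal_re, ofReal_im, I_re, I_im, add_re, mul_re]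
  ring

theorem continuous_airyKernel (η : ℝ) (z : ℂ) : Continuous (airyKernel η z) := by
  unfold airyKernel
  fun_prop

/-- The Gaussian factor `exp (-η t²)` absorbs both the polynomial and `exp (-t Im z)`. Uniformity in
`η` and `z` provides the majorants for differentiating under the integral. -/
theorem exists_airyKernel_bound (k : ℕ) {c C : ℝ} (hc : 0 < c) (hcC : c ≤ C) (M : ℝ) :
    ∃ B : ℝ, ∀ η ∈ Icc c C, ∀ z : ℂ, ‖z‖ ≤ M → ∀ t : ℝ,
      ‖((t : ℂ) + η * I) ^ k * airyKernel η z t‖ ≤ B * Real.exp (-(c / 2) * t ^ 2) := by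
  refine ⟨k.factorial * Real.exp (C + C ^ 3 / 3 + C * M + (M + 1) ^ 2 / (2 * c)), ?_⟩
  rintro η ⟨hη1, hη2⟩ z hz t
  have hη : 0 < η := hc.trans_le hη1
  have hC : 0 < C := hc.trans_le hcC
  have hM : 0 ≤ M := (norm_nonneg z).trans hz
  have h1 : ‖(t : ℂ) + η * I‖ ≤ |t| + C := by
    refine (norm_add_le _ _).trans ?_
    simp [abs_of_pos hη, hη2]
  have h2 : ‖((t : ℂ) + η * I) ^ k‖ ≤ k.factorial * Real.exp (|t| + C) := by
    rw [norm_pow]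
    have h0 : 0 ≤ |t| + C := by positivity
    have := Real.pow_div_factorial_le_exp (|t| + C) h0 k
    rw [div_le_iff₀ (by positivity)] at this
    calc _ ≤ (|t| + C) ^ k := by gcongr
      _ ≤ _ := by linarith
  rw [norm_mul, norm_airyKernel]
  refine (mul_le_mul_of_nonneg_right h2 (Real.exp_pos _).le).trans ?_
  rw [mul_assoc, mul_assoc, ← Real.exp_add, ← Real.exp_add]
  refine mul_le_mul_of_nonneg_left (Real.exp_le_exp.2 ?_) (by positivity)
  have h3 : -(η * z.re) ≤ C * M := by
    have : |z.re| ≤ M := (abs_re_le_norm z).trans hz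
    calc -(η * z.re) ≤ |η * z.re| := neg_le_abs _
      _ = η * |z.re| := by rw [abs_mul, abs_of_pos hη]
      _ ≤ C * M := by gcongr
  have h4 : -(t * z.im) ≤ |t| * M := by
    have : |z.im| ≤ M := (abs_im_le_norm z).trans hz
    calc -(t * z.im) ≤ |t * z.im| := neg_le_abs _
      _ = |t| * |z.im| := abs_mul _ _
      _ ≤ |t| * M := by gcongr
  -- Half of the Gaussian is spent here: `M` comes from `exp (-t Im z)` and `1` from bounding the
  -- power by `exp |t|`.
  have h5 : (M + 1) * |t| ≤ c / 2 * t ^ 2 + (M + 1) ^ 2 / (2 * c) := by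
    have : 0 ≤ (c * |t| - (M + 1)) ^ 2 / (2 * c) := by positivity
    have e : (c * |t| - (M + 1)) ^ 2 / (2 * c) =
        c / 2 * t ^ 2 + (M + 1) ^ 2 / (2 * c) - (M + 1) * |t| := by
      rw [← sq_abs t]
      field_simp
      ring
    linarith
  have h6 : c * t ^ 2 ≤ η * t ^ 2 := by gcongr
  have h7 : η ^ 3 ≤ C ^ 3 := by gcongr
  nlinarith

theorem integrable_pow_mul_airyKernel (k : ℕ) {η : ℝ} (hη : 0 < η) (z : ℂ) :
    Integrable fun t : ℝ => ((t : ℂ) + η * I) ^ k * airyKernel η z t := by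
  obtain ⟨B, hB⟩ := exists_airyKernel_bound k hη le_rfl ‖z‖
  refine ((integrable_exp_neg_mul_sq (half_pos hη)).const_mul B).mono' ?_
    (ae_of_all _ fun t => hB η ⟨le_rfl, le_rfl⟩ z le_rfl t)
  exact Continuous.aestronglyMeasurable
    (by have := continuous_airyKernel η z; fun_prop)

theorem integrable_airyKernel {η : ℝ} (hη : 0 < η) (z : ℂ) : Integrable (airyKernel η z) := by
  simpa using integrable_pow_mul_airyKernel 0 hη z

theorem hasDerivAt_integral_pow_mul_airyKernel (k : ℕ) {η : ℝ} (hη : 0 < η) (z : ℂ) :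
    HasDerivAt (fun z => ∫ t : ℝ, ((t : ℂ) + η * I) ^ k * airyKernel η z t)
      (∫ t : ℝ, I * (((t : ℂ) + η * I) ^ (k + 1) * airyKernel η z t)) z := by
  obtain ⟨B, hB⟩ := exists_airyKernel_bound (k + 1) hη le_rfl (‖z‖ + 1)
  refine (hasDerivAt_integral_of_dominated_loc_of_deriv_le (Metric.ball_mem_nhds z one_pos)
    (Eventually.of_forall fun w => (integrable_pow_mul_airyKernel k hη w).aestronglyMeasurable)
    (integrable_pow_mul_airyKernel k hη z)
    ((integrable_pow_mul_airyKernel (k + 1) hη z).const_mul I).aestronglyMeasurable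
    (F' := fun w t => I * (((t : ℂ) + η * I) ^ (k + 1) * airyKernel η w t))
    (ae_of_all _ fun t w hw => ?_)
    ((integrable_exp_neg_mul_sq (half_pos hη)).const_mul B) (ae_of_all _ fun t w _ => ?_)).2
  · rw [norm_mul, norm_I, one_mul]
    refine hB η ⟨le_rfl, le_rfl⟩ w ?_ t
    have := norm_sub_norm_le w z
    have h2 : ‖w - z‖ < 1 := by simpa [dist_eq_norm] using hw
    linarith
  · unfold airyKernel
    have h1 : HasDerivAt (fun w : ℂ => I * (((t : ℂ) + η * I) ^ 3 / 3 + w * (t + η * I)))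
        (I * (1 * ((t : ℂ) + η * I))) w :=
      (((hasDerivAt_id w).mul_const _).const_add _).const_mul I
    refine (h1.cexp.const_mul (((t : ℂ) + η * I) ^ k)).congr_deriv ?_
    ring

theorem hasDerivAt_airyKernel (η : ℝ) (z : ℂ) (t : ℝ) :
    HasDerivAt (airyKernel η z) (I * ((t + η * I) ^ 2 + z) * airyKernel η z t) t := by
  unfold airyKernel
  have h0 : HasDerivAt (fun t : ℝ => (t : ℂ) + η * I) 1 t := by
    simpa using (ofRealCLM.hasDerivAt (x := t)).add_const ((η : ℂ) * I)
  have h1 := ((((h0.pow 3).div_const 3).add (h0.const_mul z)).const_mul I).cexp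
  refine h1.congr_deriv ?_
  simp only [Pi.add_apply, Pi.pow_apply]
  push_cast
  ring

theorem hasDerivAt_airyKernel_shift (η : ℝ) (z : ℂ) (t : ℝ) :
    HasDerivAt (fun η : ℝ => airyKernel η z t) (-((t + η * I) ^ 2 + z) * airyKernel η z t) η := by
  unfold airyKernel
  have h0 : HasDerivAt (fun η : ℝ => (t : ℂ) + η * I) I η := by
    simpa using ((ofRealCLM.hasDerivAt (x := η)).mul_const I).const_add (t : ℂ)
  have h1 := ((((h0.pow 3).div_const 3).add (h0.const_mul z)).const_mul I).cexp
  refine h1.congr_deriv ?_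
  simp only [Pi.add_apply, Pi.pow_apply]
  push_cast
  linear_combination ((t + η * I) ^ 2 + z) * exp (I * ((t + η * I) ^ 3 / 3 + z * (t + η * I))) * I_sq

theorem integrable_sq_add_mul_airyKernel {η : ℝ} (hη : 0 < η) (z : ℂ) :
    Integrable fun t : ℝ => (((t : ℂ) + η * I) ^ 2 + z) * airyKernel η z t := by
  simp only [add_mul]
  exact (integrable_pow_mul_airyKernel 2 hη z).add ((integrable_airyKernel hη z).const_mul z)

/-- The integrand is, up to the factor `I`, the `t`-derivative of the kernel. Both the Airy equation
and the independence of the contour rest on this. -/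
theorem integral_sq_add_mul_airyKernel {η : ℝ} (hη : 0 < η) (z : ℂ) :
    ∫ t : ℝ, (((t : ℂ) + η * I) ^ 2 + z) * airyKernel η z t = 0 := by
  have h := integral_eq_zero_of_hasDerivAt_of_integrable (hasDerivAt_airyKernel η z)
    (by simpa only [mul_assoc] using (integrable_sq_add_mul_airyKernel hη z).const_mul I)
    (integrable_airyKernel hη z)
  simp only [mul_assoc, integral_const_mul] at h
  exact (mul_eq_zero.1 h).resolve_left I_ne_zero

/-- The Airy function, up to the normalising factor `2π`. -/
noncomputable def airy (z : ℂ) : ℂ := ∫ t : ℝ, airyKernel 1 z t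

theorem deriv_airy (z : ℂ) :
    deriv airy z = ∫ t : ℝ, I * (((t : ℂ) + (1 : ℝ) * I) ^ 1 * airyKernel 1 z t) := by
  have h := hasDerivAt_integral_pow_mul_airyKernel 0 one_pos z
  simp only [pow_zero, one_mul, zero_add] at h
  exact h.deriv

theorem hasDerivAt_airy (z : ℂ) : HasDerivAt airy (deriv airy z) z := by
  have h := hasDerivAt_integral_pow_mul_airyKernel 0 one_pos z
  simp only [pow_zero, one_mul, zero_add] at h
  exact h.differentiableAt.hasDerivAt

theorem differentiable_airy : Differentiable ℂ airy := fun z => (hasDerivAt_airy z).differentiableAt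

theorem hasDerivAt_deriv_airy (z : ℂ) : HasDerivAt (deriv airy) (z * airy z) z := by
  have h := (hasDerivAt_integral_pow_mul_airyKernel 1 one_pos z).const_mul I
  have e : deriv airy = fun z => I * ∫ t : ℝ, ((t : ℂ) + (1 : ℝ) * I) ^ 1 * airyKernel 1 z t := by
    ext z
    rw [deriv_airy, integral_const_mul]
  rw [e]
  refine h.congr_deriv ?_
  rw [integral_const_mul]
  have h0 := integral_sq_add_mul_airyKernel one_pos z
  simp only [add_mul] at h0
  rw [integral_add (integrable_pow_mul_airyKernel 2 one_pos z)
    ((integrable_airyKernel one_pos z).const_mul z), integral_const_mul] at h0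
  rw [airy]
  linear_combination (∫ t : ℝ, ((t : ℂ) + (1 : ℝ) * I) ^ (1 + 1) * airyKernel 1 z t) * I_sq - h0

theorem differentiable_deriv_airy : Differentiable ℂ (deriv airy) :=
  fun z => (hasDerivAt_deriv_airy z).differentiableAt

/-- Cauchy's theorem for shifting the contour, obtained by differentiating in `η`: the derivative is
the vanishing integral above. The free height is what gives decay. -/
theorem airy_eq_integral {η : ℝ} (hη : 0 < η) (z : ℂ) : airy z = ∫ t : ℝ, airyKernel η z t := by
  have hd : ∀ s : ℝ, 0 < s → HasDerivAt (fun s : ℝ => ∫ t : ℝ, airyKernel s z t) 0 s := by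
    intro s hs
    obtain ⟨B, hB⟩ := exists_airyKernel_bound 2 (half_pos hs) (show s / 2 ≤ 2 * s by linarith)
      ‖z‖
    obtain ⟨B', hB'⟩ := exists_airyKernel_bound 0 (half_pos hs) (show s / 2 ≤ 2 * s by linarith)
      ‖z‖
    have hnhds : Icc (s / 2) (2 * s) ∈ 𝓝 s := Icc_mem_nhds (by linarith) (by linarith)
    have h := (hasDerivAt_integral_of_dominated_loc_of_deriv_le (𝕜 := ℝ) (μ := volume) hnhds
      (F := fun s t => airyKernel s z t)
      (F' := fun s t => -((t + s * I) ^ 2 + z) * airyKernel s z t)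
      (bound := fun t => (B + ‖z‖ * B') * Real.exp (-(s / 2 / 2) * t ^ 2))
      (Eventually.of_forall fun w => (continuous_airyKernel w z).aestronglyMeasurable)
      (integrable_airyKernel hs z)
      (Continuous.aestronglyMeasurable (by have := continuous_airyKernel s z; fun_prop))
      (ae_of_all _ fun t w hw => ?_)
      ((integrable_exp_neg_mul_sq (half_pos (half_pos hs))).const_mul _)
      (ae_of_all _ fun t w _ => hasDerivAt_airyKernel_shift w z t)).2
    · have h0 := integral_sq_add_mul_airyKernel hs z
      simp only [neg_mul, integral_neg, h0, neg_zero] at h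
      exact h
    · have h1 := hB w hw z le_rfl t
      have h2 := hB' w hw z le_rfl t
      rw [pow_zero, one_mul] at h2
      rw [neg_mul, norm_neg, add_mul, add_mul]
      refine (norm_add_le _ _).trans (add_le_add h1 ?_)
      rw [norm_mul, mul_assoc]
      gcongr
  have hconst := (convex_Ioi (0 : ℝ)).is_const_of_fderivWithin_eq_zero (𝕜 := ℝ)
    (f := fun s : ℝ => ∫ t : ℝ, airyKernel s z t)
    (fun s hs => (hd s hs).differentiableAt.differentiableWithinAt)
    (fun s hs => by
      rw [fderivWithin_of_isOpen isOpen_Ioi hs]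
      have := (hd s hs).hasFDerivAt.fderiv
      rw [this]; ext; simp) (mem_Ioi.2 (zero_lt_one' ℝ)) (mem_Ioi.2 hη)
  exact hconst

theorem airy_conj (z : ℂ) : airy (conj z) = conj (airy z) := by
  have h : ∀ t : ℝ, airyKernel 1 (conj z) t = conj (airyKernel 1 z (-t)) := by
    intro t
    simp only [airyKernel, ← exp_conj, map_mul, map_add, map_div₀, map_pow, conj_I, conj_ofReal,
      map_ofNat]
    congr 1
    push_cast
    ring
  simp only [airy, h]
  rw [integral_conj, integral_neg_eq_self (fun t => airyKernel 1 z t)]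

/-- On the real line `airy` is, up to an exponential factor and scaling, the Fourier transform of a
nowhere vanishing kernel, so Fourier inversion excludes that it is zero throughout. -/
theorem exists_airy_ne_zero : ∃ x : ℝ, airy x ≠ 0 := by
  by_contra! h
  have hF : FourierTransform.fourier (airyKernel 1 0) = 0 := by
    ext w
    rw [Real.fourier_eq']
    have := h (-2 * Real.pi * w)
    have e : ∀ t : ℝ, exp (↑(-2 * Real.pi * inner ℝ t w) * I) • airyKernel 1 0 t =
        exp (-2 * Real.pi * w) * airyKernel 1 ((-2 * Real.pi * w : ℝ) : ℂ) t := by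
      intro t
      simp only [airyKernel, smul_eq_mul, ← exp_add]
      congr 1
      simp
      linear_combination (2 * Real.pi * w : ℂ) * I_sq
    simp only [e, integral_const_mul]
    rw [← airy, this]
    simp
  have h1 := (continuous_airyKernel 1 0).fourierInv_fourier_eq (integrable_airyKernel one_pos 0)
    (by rw [hF]; exact integrable_zero _ _ _)
  rw [hF] at h1
  have h2 := congrFun h1 0
  rw [Real.fourierInv_eq'] at h2
  simp only [Pi.zero_apply, smul_zero, integral_zero] at h2
  exact exp_ne_zero _ h2.symm

/-! ### Decay of the Airy function and of its derivative -/

theorem norm_airy_le {η : ℝ} (hη : 0 < η) (z : ℂ) :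
    ‖airy z‖ ≤ Real.sqrt (Real.pi / η) *
      Real.exp (η ^ 3 / 3 - η * z.re + z.im ^ 2 / (4 * η)) := by
  rw [airy_eq_integral hη]
  refine (norm_integral_le_integral_norm _).trans ?_
  have e : ∀ t : ℝ, ‖airyKernel η z t‖ =
      Real.exp (-η * (t + z.im / (2 * η)) ^ 2) *
        Real.exp (η ^ 3 / 3 - η * z.re + z.im ^ 2 / (4 * η)) := by
    intro t
    rw [norm_airyKernel, ← Real.exp_add]
    congr 1
    field_simp
    ring
  simp only [e]
  rw [integral_mul_const, integral_add_right_eq_self (fun t => Real.exp (-η * t ^ 2)),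
    integral_gaussian]

/-- Exponential decay of the Airy function in a sector around the positive half-line. -/
theorem norm_airy_le_exp {z : ℂ} (hre : 1 ≤ z.re) (him : |z.im| ≤ 7 / 10 * z.re) :
    ‖airy z‖ ≤ Real.sqrt Real.pi * Real.exp (-z.re / 2) := by
  -- The height `η = √(Re z)` minimises `η³/3 - η Re z`. The slope `7/10` makes the remaining term
  -- at most `49/400 p³`, which is below `p³/6`.
  set p := Real.sqrt z.re with hp
  have hp2 : p ^ 2 = z.re := Real.sq_sqrt (by linarith)
  have hp1 : 1 ≤ p := by rw [hp]; exact Real.one_le_sqrt.2 hre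
  refine (norm_airy_le (zero_lt_one.trans_le hp1) z).trans ?_
  have him2 : z.im ^ 2 ≤ 49 / 100 * p ^ 4 := by
    have := sq_le_sq' (abs_le.1 him).1 (abs_le.1 him).2
    rw [← hp2] at this
    nlinarith
  gcongr
  · exact div_le_self Real.pi_pos.le hp1
  · rw [← hp2]
    have : z.im ^ 2 / (4 * p) ≤ 49 / 400 * p ^ 3 := by
      rw [div_le_iff₀ (by positivity)]
      nlinarith
    have h3 : p ^ 2 ≤ p ^ 3 := pow_le_pow_right₀ hp1 (by norm_num)
    nlinarith

/-- Cauchy's estimate on the unit circle about `z`; this accounts for the shifts by `1`. -/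
theorem norm_deriv_airy_le_exp {z : ℂ} (hre : 2 ≤ z.re) (him : |z.im| + 1 ≤ 7 / 10 * (z.re - 1)) :
    ‖deriv airy z‖ ≤ Real.sqrt Real.pi * Real.exp (-(z.re - 1) / 2) := by
  have h := norm_deriv_le_of_forall_mem_sphere_norm_le (c := z) (R := 1) one_pos
    (differentiable_airy.diffContOnCl) (C := Real.sqrt Real.pi * Real.exp (-(z.re - 1) / 2))
    (fun w hw => ?_)
  · simpa using h
  · have hw1 : ‖w - z‖ = 1 := by simpa [dist_eq_norm] using hw
    have h1 := abs_le.1 ((abs_re_le_norm (w - z)).trans hw1.le)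
    have h2 := (abs_im_le_norm (w - z)).trans hw1.le
    rw [sub_re] at h1
    rw [sub_im] at h2
    have h3 : |w.im| ≤ |z.im| + 1 := by
      have := abs_sub_abs_le_abs_sub w.im z.im
      linarith
    refine (norm_airy_le_exp (by linarith) (by linarith)).trans ?_
    gcongr
    linarith

end RobinAiry

namespace RobinAiry

open Complex ComplexConjugate Asymptotics

/-! ### Solutions of second order linear equations on the half-line -/

/-- `v` is a solution of `v'' = q v` on `[0, ∞)` with derivative `v₁`. -/
structure IsSolution (q v v₁ : ℝ → ℂ) : Prop where
  hasDerivAt : ∀ x, 0 ≤ x → HasDerivAt v (v₁ x) x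
  hasDerivAt_deriv : ∀ x, 0 ≤ x → HasDerivAt v₁ (q x * v x) x

theorem IsSolution.eq_zero {q v v₁ : ℝ → ℂ} (hv : IsSolution q v v₁) (hq : Continuous q)
    (h0 : v 0 = 0) (h1 : v₁ 0 = 0) {x : ℝ} (hx : 0 ≤ x) : v x = 0 := by
  obtain ⟨M, hM⟩ := (isCompact_Icc (a := (0 : ℝ)) (b := x)).exists_bound_of_continuousOn
    hq.continuousOn
  have hlip : ∀ t ∈ Ico (0 : ℝ) x, LipschitzOnWith (Real.toNNReal (max 1 M))
      (fun p : ℂ × ℂ => (p.2, q t * p.1)) univ := by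
    intro t ht
    refine (LipschitzWith.of_dist_le_mul fun p p' => ?_).lipschitzOnWith
    have hK : (Real.toNNReal (max 1 M) : ℝ) = max 1 M :=
      Real.coe_toNNReal _ (zero_le_one.trans (le_max_left _ _))
    rw [hK, dist_eq_norm, dist_eq_norm, Prod.mk_sub_mk, ← mul_sub, Prod.norm_mk, norm_mul]
    have h2 : ‖p.2 - p'.2‖ ≤ ‖p - p'‖ := norm_snd_le (p - p')
    have h3 : ‖p.1 - p'.1‖ ≤ ‖p - p'‖ := norm_fst_le (p - p')
    refine max_le ?_ ?_
    · calc _ ≤ 1 * ‖p - p'‖ := by rwa [one_mul]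
        _ ≤ _ := by gcongr; exact le_max_left _ _
    · gcongr
      exact (hM t ⟨ht.1, ht.2.le⟩).trans (le_max_right _ _)
  have hd : ∀ t, 0 ≤ t → HasDerivAt (fun t => (v t, v₁ t)) (v₁ t, q t * v t) t :=
    fun t ht => (hv.hasDerivAt t ht).prodMk (hv.hasDerivAt_deriv t ht)
  have h := ODE_solution_unique_of_mem_Icc_right (f := fun t => (v t, v₁ t))
    (g := fun _ => (0 : ℂ × ℂ)) (v := fun t p => (p.2, q t * p.1)) hlip
    (fun t ht => (hd t ht.1).continuousAt.continuousWithinAt)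
    (fun t ht => (hd t ht.1).hasDerivWithinAt) (fun _ _ => mem_univ _) continuousOn_const
    (fun t _ => (hasDerivAt_const t (0 : ℂ × ℂ)).hasDerivWithinAt.congr_deriv (by simp; rfl))
    (fun _ _ => mem_univ _) (by simp [h0, h1])
  exact congrArg Prod.fst (h ⟨hx, le_rfl⟩)

/-- The Wronskian of two solutions in `L²` with derivatives in `L²` vanishes. -/
theorem IsSolution.wronskian_eq_zero {q u u₁ v v₁ : ℝ → ℂ} (hu : IsSolution q u u₁)
    (hv : IsSolution q v v₁) (mu : MemLp u 2 halfLine) (mu₁ : MemLp u₁ 2 halfLine)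
    (mv : MemLp v 2 halfLine) (mv₁ : MemLp v₁ 2 halfLine) : u 0 * v₁ 0 - u₁ 0 * v 0 = 0 := by
  have hd : ∀ x, 0 ≤ x → HasDerivAt (fun x => u x * v₁ x - u₁ x * v x) 0 x := by
    intro x hx
    refine (((hu.hasDerivAt x hx).mul (hv.hasDerivAt_deriv x hx)).sub
      ((hu.hasDerivAt_deriv x hx).mul (hv.hasDerivAt x hx))).congr_deriv ?_
    ring
  have hconst : ∀ x, 0 ≤ x → u x * v₁ x - u₁ x * v x = u 0 * v₁ 0 - u₁ 0 * v 0 := fun x hx =>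
    constant_of_has_deriv_right_zero (a := 0) (b := x)
      (fun y hy => (hd y hy.1).continuousAt.continuousWithinAt)
      (fun y hy => (hd y hy.1).hasDerivWithinAt) x ⟨hx, le_rfl⟩
  -- Products of `L²` functions are integrable, whereas a nonzero constant is not integrable on a
  -- half-line.
  have hint : Integrable (fun x => u x * v₁ x - u₁ x * v x) halfLine :=
    (mu.integrable_mul mv₁).sub (mu₁.integrable_mul mv)
  have hint2 : IntegrableOn (fun _ : ℝ => u 0 * v₁ 0 - u₁ 0 * v 0) (Ioi 0) := by
    refine hint.congr ?_
    filter_upwards [ae_restrict_mem measurableSet_Ioi] with x hx using hconst x (le_of_lt hx)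
  rw [integrableOn_const_iff] at hint2
  simpa using hint2

/-- An `H²` function satisfying `u'' = q u` almost everywhere is a classical solution. -/
theorem IsH2.exists_isSolution {q u u₁ u₂ : ℝ → ℂ} (hu : IsH2 u u₁ u₂) (hq : Continuous q)
    (h : u₂ =ᵐ[halfLine] fun x => q x * u x) :
    ∃ U U₁ : ℝ → ℂ, IsSolution q U U₁ ∧ (∀ x, 0 ≤ x → U x = u x) ∧ ∀ x, 0 ≤ x → U₁ x = u₁ x := by
  have hint : ∀ a b : ℝ, IntervalIntegrable ((Ioi (0 : ℝ)).indicator u₁) volume a b := by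
    intro a b
    have h1 : MemLp ((Ioi (0 : ℝ)).indicator u₁) 2 volume :=
      (memLp_indicator_iff_restrict measurableSet_Ioi).2 hu.memLp_one
    exact ((h1.locallyIntegrable (by norm_num)).integrableOn_isCompact
      isCompact_uIcc).intervalIntegrable
  have hcont : Continuous fun x => u 0 + ∫ t in (0 : ℝ)..x, (Ioi (0 : ℝ)).indicator u₁ t :=
    continuous_const.add (intervalIntegral.continuous_primitive hint 0)
  -- Nothing is known of `u` on the negative axis. Freezing it at `u 0` there and integrating twice
  -- yields functions differentiable from both sides at `0`.
  have hw : Continuous fun x => u (max x 0) := by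
    have e : (fun x => u (max x 0)) =
        (fun x => u 0 + ∫ t in (0 : ℝ)..x, (Ioi (0 : ℝ)).indicator u₁ t) ∘ fun x => max x 0 := by
      ext x
      have hx : 0 ≤ max x 0 := le_max_right _ _
      rw [Function.comp, hu.eq_integral _ hx]
      congr 1
      refine intervalIntegral.integral_congr_ae (ae_of_all _ fun t ht => ?_)
      rw [uIoc_of_le hx] at ht
      rw [indicator_of_mem (show t ∈ Ioi (0 : ℝ) from ht.1)]
    rw [e]
    exact hcont.comp (continuous_id.max continuous_const)
  have hqw : Continuous fun x => q x * u (max x 0) := hq.mul hw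
  set U₁ : ℝ → ℂ := fun x => u₁ 0 + ∫ t in (0 : ℝ)..x, q t * u (max t 0) with hU₁
  have hdU₁ : ∀ x, HasDerivAt U₁ (q x * u (max x 0)) x := fun x =>
    (hqw.integral_hasStrictDerivAt 0 x).hasDerivAt.const_add _
  have hcU₁ : Continuous U₁ := continuous_iff_continuousAt.2 fun x => (hdU₁ x).continuousAt
  have e1 : ∀ x, 0 ≤ x → U₁ x = u₁ x := by
    intro x hx
    rw [hu.one_eq_integral x hx, hU₁]
    simp only
    congr 1
    rw [intervalIntegral.integral_of_le hx, intervalIntegral.integral_of_le hx]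
    refine integral_congr_ae ?_
    have h' := ae_restrict_of_ae_restrict_of_subset (s := Ioc 0 x) (fun t ht => ht.1) h
    filter_upwards [h', ae_restrict_mem measurableSet_Ioc] with t ht htx
    rw [ht, max_eq_left htx.1.le]
  set U : ℝ → ℂ := fun x => u 0 + ∫ t in (0 : ℝ)..x, U₁ t with hU
  have hdU : ∀ x, HasDerivAt U (U₁ x) x := fun x =>
    (hcU₁.integral_hasStrictDerivAt 0 x).hasDerivAt.const_add _
  have e0 : ∀ x, 0 ≤ x → U x = u x := by
    intro x hx
    rw [hu.eq_integral x hx, hU]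
    simp only
    congr 1
    refine intervalIntegral.integral_congr fun t ht => e1 t ?_
    rw [uIcc_of_le hx] at ht
    exact ht.1
  refine ⟨U, U₁, ⟨fun x _ => hdU x, fun x hx => ?_⟩, e0, e1⟩
  rw [e0 x hx]
  simpa [max_eq_left hx] using hdU₁ x

/-! ### The Airy function along a ray -/

theorem hasDerivAt_airy_ray (a b : ℂ) (x : ℝ) :
    HasDerivAt (fun x : ℝ => airy (a * x + b)) (a * deriv airy (a * x + b)) x := by
  have h0 : HasDerivAt (fun x : ℝ => a * (x : ℂ) + b) a x := by
    simpa using ((ofRealCLM.hasDerivAt (x := x)).const_mul a).add_const b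
  exact ((hasDerivAt_airy _).comp x h0).congr_deriv (mul_comm _ _)

theorem hasDerivAt_deriv_airy_ray (a b : ℂ) (x : ℝ) :
    HasDerivAt (fun x : ℝ => a * deriv airy (a * x + b))
      (a ^ 2 * (a * x + b) * airy (a * x + b)) x := by
  have h0 : HasDerivAt (fun x : ℝ => a * (x : ℂ) + b) a x := by
    simpa using ((ofRealCLM.hasDerivAt (x := x)).const_mul a).add_const b
  exact (((hasDerivAt_deriv_airy _).comp x h0).const_mul a).congr_deriv (by ring)

theorem isSolution_airy_ray (a b : ℂ) :
    IsSolution (fun x => a ^ 2 * (a * x + b)) (fun x => airy (a * x + b))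
      (fun x => a * deriv airy (a * x + b)) :=
  ⟨fun x _ => hasDerivAt_airy_ray a b x, fun x _ => hasDerivAt_deriv_airy_ray a b x⟩

/-- By the identity theorem, vanishing on a ray would force the entire function `airy` to vanish. -/
theorem exists_airy_ray_ne_zero {a : ℂ} (ha : a ≠ 0) (b : ℂ) :
    ∃ x : ℝ, 0 < x ∧ airy (a * x + b) ≠ 0 := by
  by_contra! h
  have hd : Differentiable ℂ fun z => airy (a * z + b) :=
    differentiable_airy.comp ((differentiable_id.const_mul a).add_const b)
  have hz : (fun z => airy (a * z + b)) = fun _ => 0 := by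
    refine AnalyticOnNhd.eq_of_frequently_eq (z₀ := 0)
      (fun z _ => hd.analyticAt z) (fun z _ => analyticAt_const) ?_
    have ht : Tendsto (fun x : ℝ => (x : ℂ)) (𝓝[>] 0) (𝓝[≠] 0) := by
      refine tendsto_nhdsWithin_iff.2 ⟨?_, ?_⟩
      · exact (continuous_ofReal.tendsto' 0 0 rfl).mono_left nhdsWithin_le_nhds
      · filter_upwards [self_mem_nhdsWithin] with x hx
        simpa using (ne_of_gt hx)
    refine ht.frequently (Eventually.frequently ?_)
    filter_upwards [self_mem_nhdsWithin] with x hx using h x hx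
  obtain ⟨y, hy⟩ := exists_airy_ne_zero
  refine hy ?_
  have := congrFun hz ((y - b) / a)
  simpa [mul_div_cancel₀ _ ha] using this

/-- The ray has slope at most `3/5 < 7/10`, so any translate ends up inside the sector of decay. -/
theorem eventually_sector {a : ℂ} (ha : 0 < a.re) (ha' : |a.im| ≤ 3 / 5 * a.re) (b : ℂ) :
    ∀ᶠ x : ℝ in atTop, 2 ≤ (a * x + b).re ∧
      |(a * x + b).im| + 1 ≤ 7 / 10 * ((a * x + b).re - 1) := by
  have h1 : Tendsto (fun x : ℝ => a.re * x) atTop atTop := tendsto_id.const_mul_atTop ha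
  filter_upwards [h1.eventually_ge_atTop (2 - b.re), eventually_ge_atTop 0,
    h1.eventually_ge_atTop (10 * (|b.im| + 1 + 7 / 10 * (1 - b.re)))] with x hx hx0 hx2
  have er : (a * x + b).re = a.re * x + b.re := by simp
  have ei : (a * x + b).im = a.im * x + b.im := by simp
  rw [er, ei]
  refine ⟨by linarith, ?_⟩
  have : |a.im * x + b.im| ≤ 3 / 5 * a.re * x + |b.im| := by
    refine (abs_add_le _ _).trans ?_
    rw [abs_mul, abs_of_nonneg hx0]
    gcongr
  linarith

theorem isBigO_airy_ray {a : ℂ} (ha : 0 < a.re) (ha' : |a.im| ≤ 3 / 5 * a.re) (b : ℂ) :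
    (fun x : ℝ => airy (a * x + b)) =O[atTop] fun x => Real.exp (-(a.re / 2) * x) := by
  refine IsBigO.of_bound (Real.sqrt Real.pi * Real.exp (-b.re / 2)) ?_
  filter_upwards [eventually_sector ha ha' b] with x hx
  refine (norm_airy_le_exp (by linarith [hx.1]) (by linarith [hx.2])).trans (le_of_eq ?_)
  rw [Real.norm_of_nonneg (Real.exp_pos _).le, mul_assoc, ← Real.exp_add]
  congr 2
  simp
  ring

theorem isBigO_deriv_airy_ray {a : ℂ} (ha : 0 < a.re) (ha' : |a.im| ≤ 3 / 5 * a.re) (b : ℂ) :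
    (fun x : ℝ => a * deriv airy (a * x + b)) =O[atTop] fun x => Real.exp (-(a.re / 2) * x) := by
  refine IsBigO.const_mul_left (IsBigO.of_bound
    (Real.sqrt Real.pi * Real.exp ((1 - b.re) / 2)) ?_) a
  filter_upwards [eventually_sector ha ha' b] with x hx
  refine (norm_deriv_airy_le_exp hx.1 hx.2).trans (le_of_eq ?_)
  rw [Real.norm_of_nonneg (Real.exp_pos _).le, mul_assoc, ← Real.exp_add]
  congr 2
  simp
  ring

theorem memLp_two_of_isBigO_exp {f : ℝ → ℂ} (hf : Continuous f) {δ : ℝ} (hδ : 0 < δ)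
    (h : f =O[atTop] fun x => Real.exp (-δ * x)) : MemLp f 2 halfLine := by
  rw [memLp_two_iff_integrable_sq_norm hf.aestronglyMeasurable]
  refine integrable_of_isBigO_exp_neg (b := 2 * δ) (by linarith) (by fun_prop) ?_
  refine (h.norm_left.pow 2).congr_right fun x => ?_
  rw [← Real.exp_nat_mul]
  congr 1
  push_cast
  ring

theorem isBigO_mul_of_isBigO_exp {f : ℝ → ℂ} {δ : ℝ} (hδ : 0 < δ)
    (h : f =O[atTop] fun x => Real.exp (-δ * x)) :
    (fun x : ℝ => (x : ℂ) * f x) =O[atTop] fun x => Real.exp (-(δ / 2) * x) := by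
  have h1 : (fun x : ℝ => (x : ℂ)) =O[atTop] fun x => Real.exp (δ / 2 * x) := by
    have := (isLittleO_pow_exp_pos_mul_atTop 1 (half_pos hδ)).isBigO
    refine (IsBigO.of_norm_left ?_)
    simpa using this.norm_left
  refine (h1.mul h).congr_right fun x => ?_
  rw [← Real.exp_add]
  congr 1
  ring

/-! ### The secular equation -/

/-- The direction `exp (iπ/6)`. -/
noncomputable def dir : ℂ := ⟨Real.sqrt 3 / 2, 1 / 2⟩

theorem dir_sq : dir ^ 2 = ⟨1 / 2, Real.sqrt 3 / 2⟩ := by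
  have := Real.mul_self_sqrt (show (0 : ℝ) ≤ 3 by norm_num)
  rw [sq, dir]
  apply Complex.ext <;> simp <;> nlinarith

theorem dir_cube : dir ^ 3 = I := by
  have := Real.mul_self_sqrt (show (0 : ℝ) ≤ 3 by norm_num)
  rw [pow_succ, dir_sq, dir]
  apply Complex.ext <;> simp <;> nlinarith

theorem dir_ne_zero : dir ≠ 0 := fun h => by
  have := congrArg im h
  norm_num [dir] at this

/-- The function of `z` whose zeros are the eigenvalues of `-d²/dx² + i x` with the boundary
condition `u'(0) = s u(0)`. -/
noncomputable def secular (s : ℝ) (z : ℂ) : ℂ :=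
  dir * deriv airy (-z / dir ^ 2) - s * airy (-z / dir ^ 2)

theorem dir_sector {τ : ℝ} (hτ : 0 < τ) :
    0 < ((τ : ℂ) * dir).re ∧ |((τ : ℂ) * dir).im| ≤ 3 / 5 * ((τ : ℂ) * dir).re := by
  have h3 : (5 / 3 : ℝ) < Real.sqrt 3 := Real.lt_sqrt_of_sq_lt (by norm_num)
  have h1 : ((τ : ℂ) * dir).re = τ * (Real.sqrt 3 / 2) := by simp [dir]
  have h2 : ((τ : ℂ) * dir).im = τ * (1 / 2) := by simp [dir]
  rw [h1, h2, abs_of_pos (by positivity)]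
  constructor
  · positivity
  · nlinarith

theorem isEigenvalue_robinAiry_iff_graph (j κ : ℝ) (z : ℂ) :
    IsEigenvalue (robinAiry j κ) z ↔ ∃ p : L2, p ≠ 0 ∧ (p, z • p) ∈ graph j κ := by
  rw [← robinAiry_graph]
  constructor
  · rintro ⟨v, hv, h⟩
    exact ⟨v, hv, (LinearPMap.mem_graph_iff _).2 ⟨v, rfl, h⟩⟩
  · rintro ⟨p, hp, h⟩
    obtain ⟨v, hv, h⟩ := (LinearPMap.mem_graph_iff _).1 h
    refine ⟨v, by rwa [hv], ?_⟩
    rw [h, hv]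

theorem secular_rescale {τ : ℝ} (hτ : 0 < τ) (κ : ℝ) (z : ℂ) :
    secular (κ / τ) (z / τ ^ 2) = 0 ↔
      τ * dir * deriv airy (-z / (τ * dir) ^ 2) = κ * airy (-z / (τ * dir) ^ 2) := by
  have hτ' : (τ : ℂ) ≠ 0 := by exact_mod_cast hτ.ne'
  have e : -(z / τ ^ 2) / dir ^ 2 = -z / (τ * dir) ^ 2 := by
    rw [mul_pow, ← neg_div, div_div]
  rw [secular, e, sub_eq_zero, ofReal_div, mul_assoc, div_mul_eq_mul_div, eq_div_iff hτ', mul_comm _ (τ : ℂ)]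

/-- With `a = τ dir` one has `a³ = i τ³`, so `x ↦ airy (a x - z / a²)` is a decaying solution. The
Wronskian identity ties every eigenfunction to it, which leaves only the boundary condition. -/
theorem isEigenvalue_robinAiry_iff {τ : ℝ} (hτ : 0 < τ) (κ : ℝ) (z : ℂ) :
    IsEigenvalue (robinAiry (τ ^ 3) κ) z ↔ secular (κ / τ) (z / τ ^ 2) = 0 := by
  rw [isEigenvalue_robinAiry_iff_graph, secular_rescale hτ]
  have hτ' : (τ : ℂ) ≠ 0 := by exact_mod_cast hτ.ne'
  obtain ⟨har, hai⟩ := dir_sector hτ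
  have ha0 : (τ : ℂ) * dir ≠ 0 := mul_ne_zero hτ' dir_ne_zero
  have ha3 : ((τ : ℂ) * dir) ^ 3 = I * τ ^ 3 := by rw [mul_pow, dir_cube, mul_comm]
  generalize (τ : ℂ) * dir = a at *
  set b : ℂ := -z / a ^ 2 with hb
  have hq : ∀ x : ℝ, a ^ 2 * (a * x + b) = I * ((τ ^ 3 : ℝ) : ℂ) * x - z := by
    intro x
    rw [hb]
    push_cast
    rw [← ha3]
    field_simp
    ring
  have hsol := isSolution_airy_ray a b
  simp only [hq] at hsol
  have hδ : 0 < a.re / 2 := half_pos har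
  have hO := isBigO_airy_ray har hai b
  have hc : Continuous fun x : ℝ => airy (a * x + b) :=
    continuous_iff_continuousAt.2 fun x => (hasDerivAt_airy_ray a b x).continuousAt
  have hc₁ : Continuous fun x : ℝ => a * deriv airy (a * x + b) :=
    continuous_iff_continuousAt.2 fun x => (hasDerivAt_deriv_airy_ray a b x).continuousAt
  have mv := memLp_two_of_isBigO_exp hc hδ hO
  have mv₁ := memLp_two_of_isBigO_exp hc₁ hδ (isBigO_deriv_airy_ray har hai b)
  have mxv := memLp_two_of_isBigO_exp (continuous_ofReal.mul hc) (half_pos hδ)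
    (isBigO_mul_of_isBigO_exp hδ hO)
  constructor
  · rintro ⟨p, hp, u, u₁, u₂, hu, -, hbc, h1, h2⟩
    have hode : u₂ =ᵐ[halfLine] fun x => (I * ((τ ^ 3 : ℝ) : ℂ) * x - z) * u x := by
      filter_upwards [h1, h2, Lp.coeFn_smul z p] with x hx1 hx2 hx3
      rw [hx3, Pi.smul_apply, smul_eq_mul, hx1] at hx2
      linear_combination hx2
    obtain ⟨U, U₁, hU, e0, e1⟩ := hu.exists_isSolution (by fun_prop) hode
    have aeU : ∀ {f g : ℝ → ℂ}, (∀ x, 0 ≤ x → f x = g x) → g =ᵐ[halfLine] f := by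
      intro f g h
      filter_upwards [ae_restrict_mem measurableSet_Ioi] with x hx using (h x (le_of_lt hx)).symm
    have hW := hU.wronskian_eq_zero hsol (hu.memLp.ae_eq (aeU e0)) (hu.memLp_one.ae_eq (aeU e1))
      mv mv₁
    simp only [ofReal_zero, mul_zero, zero_add, e0 0 le_rfl, e1 0 le_rfl, hbc] at hW
    -- The Wronskian is `u(0)` times the defect of the Airy solution in the boundary condition. If
    -- the defect is nonzero, the Cauchy data of `u` at `0` vanish.
    by_contra hne
    have hu0 : u 0 = 0 := by
      have : u 0 * (a * deriv airy b - κ * airy b) = 0 := by linear_combination hW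
      exact (mul_eq_zero.1 this).resolve_right (sub_ne_zero.2 hne)
    refine hp (Lp.ext ?_)
    filter_upwards [h1, Lp.coeFn_zero ℂ 2 halfLine, ae_restrict_mem measurableSet_Ioi]
      with x hx1 hx2 hx3
    rw [hx1, hx2]
    simp only [Pi.zero_apply]
    rw [← e0 x (le_of_lt hx3)]
    refine hU.eq_zero (by fun_prop) ?_ ?_ (le_of_lt hx3)
    · rw [e0 0 le_rfl, hu0]
    · rw [e1 0 le_rfl, hbc, hu0, mul_zero]
  · intro hbc
    have hH2 : IsH2 (fun x => airy (a * x + b)) (fun x => a * deriv airy (a * x + b))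
        (fun x => (I * ((τ ^ 3 : ℝ) : ℂ) * x - z) * airy (a * x + b)) := by
      refine ⟨mv, mv₁, ?_, fun x hx => ?_, fun x hx => ?_⟩
      · have e : (fun x : ℝ => (I * ((τ ^ 3 : ℝ) : ℂ) * x - z) * airy (a * x + b)) =
            (I * ((τ ^ 3 : ℝ) : ℂ)) • (fun x : ℝ => (x : ℂ) * airy (a * x + b)) +
              (-z) • fun x : ℝ => airy (a * x + b) := by
          ext x
          simp only [Pi.add_apply, Pi.smul_apply, smul_eq_mul]
          ring
        rw [e]
        exact (mxv.const_smul _).add (mv.const_smul _)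
      · rw [intervalIntegral.integral_eq_sub_of_hasDerivAt
          (fun t _ => hasDerivAt_airy_ray a b t) (hc₁.intervalIntegrable _ _)]
        ring
      · rw [intervalIntegral.integral_eq_sub_of_hasDerivAt (f := fun x => a * deriv airy (a * x + b))
          (fun t ht => hsol.hasDerivAt_deriv t (by rw [uIcc_of_le hx] at ht; exact ht.1))
          (Continuous.intervalIntegrable (by fun_prop) _ _)]
        ring
    refine ⟨mv.toLp _, fun h0 => ?_, _, _, _, hH2, mxv, ?_, mv.coeFn_toLp, ?_⟩
    · have h0' : (fun x : ℝ => airy (a * x + b)) =ᵐ[halfLine] 0 := by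
        have := mv.coeFn_toLp
        rw [h0] at this
        exact this.symm.trans (Lp.coeFn_zero ℂ 2 halfLine)
      obtain ⟨x, hx, hne⟩ := exists_airy_ray_ne_zero ha0 b
      exact hne ((primitive_eq_zero mv₁ hH2.eq_integral h0').1 x hx.le)
    · simpa using hbc
    · filter_upwards [Lp.coeFn_smul z (mv.toLp _), mv.coeFn_toLp] with x hx1 hx2
      rw [hx1, Pi.smul_apply, smul_eq_mul, hx2]
      ring

end RobinAiry

namespace RobinAiry

open Complex ComplexConjugate Asymptotics

/-! ### Energy estimates -/

theorem add_mul_le_of_hasDerivAt {f f' : ℝ → ℝ} {a c : ℝ}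
    (hf : ∀ x, a ≤ x → HasDerivAt f (f' x) x) (hc : ∀ x, a ≤ x → c ≤ f' x) {x : ℝ} (hx : a ≤ x) :
    f a + c * (x - a) ≤ f x := by
  have h := (convex_Ici a).mul_sub_le_image_sub_of_le_deriv (f := f) (C := c)
    (fun y hy => (hf y hy).continuousAt.continuousWithinAt)
    (fun y hy => (hf y (interior_subset hy)).differentiableAt.differentiableWithinAt)
    (fun y hy => by
      rw [(hf y (interior_subset hy)).deriv]
      exact hc y (interior_subset hy)) a self_mem_Ici x hx hx
  linarith

/-- A nondecreasing function that starts nonnegative and tends to `0` is identically `0`. This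
replaces integration by parts over the half-line in the energy arguments. -/
theorem deriv_eq_zero_of_nonneg_of_tendsto {R R' : ℝ → ℝ}
    (hR : ∀ x, 0 ≤ x → HasDerivAt R (R' x) x) (hR' : ∀ x, 0 ≤ x → 0 ≤ R' x) (h0 : 0 ≤ R 0)
    (hlim : Tendsto R atTop (𝓝 0)) {x : ℝ} (hx : 0 < x) : R' x = 0 := by
  have hmono : ∀ a b, 0 ≤ a → a ≤ b → R a ≤ R b := fun a b ha hab => by
    simpa using add_mul_le_of_hasDerivAt (fun y hy => hR y (ha.trans hy))
      (fun y hy => hR' y (ha.trans hy)) hab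
  have hz : ∀ y, 0 ≤ y → R y = 0 := fun y hy =>
    le_antisymm (ge_of_tendsto hlim (by
      filter_upwards [eventually_ge_atTop y] with t ht using hmono y t hy ht))
      (h0.trans (hmono 0 y le_rfl hy))
  refine (hR x hx.le).unique ((hasDerivAt_const x (0 : ℝ)).congr_of_eventuallyEq ?_)
  filter_upwards [Ioi_mem_nhds hx] with y hy using hz y (le_of_lt hy)

theorem IsSolution.hasDerivAt_conj_mul {q v v₁ : ℝ → ℂ} (hv : IsSolution q v v₁) {x : ℝ}
    (hx : 0 ≤ x) :
    HasDerivAt (fun x => conj (v x) * v₁ x)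
      ((normSq (v₁ x) : ℂ) + q x * (normSq (v x) : ℂ)) x := by
  refine ((hv.hasDerivAt x hx).star.mul (hv.hasDerivAt_deriv x hx)).congr_deriv ?_
  simp only [← mul_conj, RCLike.star_def]
  ring

theorem IsSolution.hasDerivAt_re {q v v₁ : ℝ → ℂ} (hv : IsSolution q v v₁) {x : ℝ} (hx : 0 ≤ x) :
    HasDerivAt (fun x => (conj (v x) * v₁ x).re)
      (normSq (v₁ x) + (q x).re * normSq (v x)) x := by
  refine (reCLM.hasFDerivAt.comp_hasDerivAt x (hv.hasDerivAt_conj_mul hx)).congr_deriv ?_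
  simp

theorem IsSolution.hasDerivAt_im {q v v₁ : ℝ → ℂ} (hv : IsSolution q v v₁) {x : ℝ} (hx : 0 ≤ x) :
    HasDerivAt (fun x => (conj (v x) * v₁ x).im) ((q x).im * normSq (v x)) x := by
  refine (imCLM.hasFDerivAt.comp_hasDerivAt x (hv.hasDerivAt_conj_mul hx)).congr_deriv ?_
  simp

theorem IsSolution.hasDerivAt_normSq {q v v₁ : ℝ → ℂ} (hv : IsSolution q v v₁) {x : ℝ}
    (hx : 0 ≤ x) :
    HasDerivAt (fun x => normSq (v x)) (2 * (conj (v x) * v₁ x).re) x := by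
  have h1 := (hv.hasDerivAt x hx).star.mul (hv.hasDerivAt x hx)
  have h2 := reCLM.hasFDerivAt.comp_hasDerivAt x h1
  refine (h2.congr_deriv ?_).congr_of_eventuallyEq (Eventually.of_forall fun y => ?_)
  · simp
    ring
  · simp [normSq_apply]

theorem IsSolution.im_mul_normSq_eq_zero {q v v₁ : ℝ → ℂ} (hv : IsSolution q v v₁)
    (hlim : Tendsto v atTop (𝓝 0)) (hlim₁ : Tendsto v₁ atTop (𝓝 0))
    (h0 : (conj (v 0) * v₁ 0).im = 0) (β : ℝ) (hq : ∀ x, 0 ≤ x → 0 ≤ β * (q x).im) {x : ℝ}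
    (hx : 0 < x) : β * ((q x).im * normSq (v x)) = 0 := by
  refine deriv_eq_zero_of_nonneg_of_tendsto (R := fun x => β * (conj (v x) * v₁ x).im)
    (fun y hy => (hv.hasDerivAt_im hy).const_mul β) (fun y hy => ?_) (by rw [h0, mul_zero]) ?_ hx
  · rw [← mul_assoc]
    exact mul_nonneg (hq y hy) (normSq_nonneg _)
  · have h1 := ((continuous_conj.tendsto' 0 0 (map_zero _)).comp hlim).mul hlim₁
    have h2 := ((continuous_im.tendsto _).comp h1).const_mul β
    simpa using h2

/-- For `h(y) = -2y/(2+y)` the right side is `y - h' - h²`. Completing the square with this `h`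
bounds the Neumann ground state energy of `-d²/dy² + y` from below. -/
theorem weight_bound {y : ℝ} (hy : 0 ≤ y) :
    19 / 20 ≤ y + 4 / (2 + y) ^ 2 - (2 * y / (2 + y)) ^ 2 := by
  have h : 0 < 2 + y := by linarith
  have e : y + 4 / (2 + y) ^ 2 - (2 * y / (2 + y)) ^ 2 =
      (y * (2 + y) ^ 2 + 4 - 4 * y ^ 2) / (2 + y) ^ 2 := by
    field_simp
    ring
  rw [e, le_div_iff₀ (by positivity)]
  rcases le_total y 1 with h1 | h1
  · nlinarith [mul_nonneg hy (sq_nonneg (y - 19 / 40))]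
  · nlinarith [mul_nonneg (sub_nonneg.2 h1) (sq_nonneg y)]

/-- A variational lower bound with the weight `-2 τ² x / (2 + τ x)`: a decaying solution with
`v'(0) = s v(0)`, `s ≥ 0`, vanishes if its potential is small. -/
theorem IsSolution.eq_zero_of_energy {q v v₁ : ℝ → ℂ} (hv : IsSolution q v v₁)
    (hlim : Tendsto v atTop (𝓝 0)) (hlim₁ : Tendsto v₁ atTop (𝓝 0)) {s : ℝ} (hs : 0 ≤ s)
    (h0 : v₁ 0 = s * v 0) (β : ℝ) {τ : ℝ} (hτ : 0 < τ)
    (hq : ∀ x, 0 ≤ x → 0 < (q x).re + β * (q x).im - τ ^ 3 * x + 19 / 20 * τ ^ 2) {x : ℝ}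
    (hx : 0 < x) : v x = 0 := by
  set h : ℝ → ℝ := fun x => -(2 * τ ^ 2 * x / (2 + τ * x)) with hh
  have hpos : ∀ x, 0 ≤ x → 0 < 2 + τ * x := fun x hx => by positivity
  have hd : ∀ x, 0 ≤ x → HasDerivAt h (-(4 * τ ^ 2 / (2 + τ * x) ^ 2)) x := by
    intro x hx
    have h1 : HasDerivAt (fun x => 2 * τ ^ 2 * x) (2 * τ ^ 2) x := by
      simpa using (hasDerivAt_id x).const_mul (2 * τ ^ 2)
    have h2 : HasDerivAt (fun x => 2 + τ * x) τ x := by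
      simpa using ((hasDerivAt_id x).const_mul τ).const_add 2
    refine (h1.div h2 (hpos x hx).ne').neg.congr_deriv ?_
    ring
  have hbd : ∀ x, 0 ≤ x → |h x| ≤ 2 * τ := by
    intro x hx
    rw [hh, abs_neg, abs_of_nonneg (div_nonneg (by positivity) (hpos x hx).le),
      div_le_iff₀ (hpos x hx)]
    nlinarith [mul_nonneg hτ.le hx]
  have hweight : ∀ x, 0 ≤ x →
      19 / 20 * τ ^ 2 ≤ τ ^ 3 * x + 4 * τ ^ 2 / (2 + τ * x) ^ 2 - h x ^ 2 := by
    intro x hx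
    have := mul_le_mul_of_nonneg_left (weight_bound (mul_nonneg hτ.le hx)) (sq_nonneg τ)
    have e : τ ^ 2 * (τ * x + 4 / (2 + τ * x) ^ 2 - (2 * (τ * x) / (2 + τ * x)) ^ 2) =
        τ ^ 3 * x + 4 * τ ^ 2 / (2 + τ * x) ^ 2 - h x ^ 2 := by
      rw [hh]
      have := (hpos x hx).ne'
      field_simp
    linarith
  -- Completing the square, with `-h' = 4τ²/(2 + τx)²`. Since `h 0 = 0`, the initial value is `s
  -- |v(0)|² ≥ 0`; since `h` is bounded, the limit at infinity is `0`.
  have hR : ∀ x, 0 ≤ x → HasDerivAt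
      (fun x => (conj (v x) * v₁ x).re + β * (conj (v x) * v₁ x).im - h x * normSq (v x))
      (normSq (v₁ x - h x * v x) +
        ((q x).re + β * (q x).im + 4 * τ ^ 2 / (2 + τ * x) ^ 2 - h x ^ 2) * normSq (v x)) x := by
    intro x hx
    refine (((hv.hasDerivAt_re hx).add ((hv.hasDerivAt_im hx).const_mul β)).sub
      ((hd x hx).mul (hv.hasDerivAt_normSq hx))).congr_deriv ?_
    simp only [normSq_apply, mul_re, mul_im, sub_re, sub_im, conj_re, conj_im, ofReal_re, ofReal_im]
    ring
  have hcoef : ∀ x, 0 ≤ x →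
      0 < (q x).re + β * (q x).im + 4 * τ ^ 2 / (2 + τ * x) ^ 2 - h x ^ 2 := fun x hx => by
    linarith [hq x hx, hweight x hx]
  have hz := deriv_eq_zero_of_nonneg_of_tendsto hR
    (fun y hy => add_nonneg (normSq_nonneg _) (mul_nonneg (hcoef y hy).le (normSq_nonneg _)))
    ?_ ?_ hx
  · have h1 := normSq_nonneg (v₁ x - h x * v x)
    have h2 := mul_nonneg (hcoef x hx.le).le (normSq_nonneg (v x))
    have h3 : ((q x).re + β * (q x).im + 4 * τ ^ 2 / (2 + τ * x) ^ 2 - h x ^ 2) *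
        normSq (v x) = 0 := by linarith
    exact normSq_eq_zero.1 ((mul_eq_zero.1 h3).resolve_left (hcoef x hx.le).ne')
  · have e : conj (v 0) * v₁ 0 = ((s * normSq (v 0) : ℝ) : ℂ) := by
      rw [h0]
      push_cast
      rw [← mul_conj]
      ring
    have e2 : h 0 = 0 := by simp [hh]
    rw [e, e2, ofReal_re, ofReal_im]
    have := mul_nonneg hs (normSq_nonneg (v 0))
    linarith
  · have h1 := ((continuous_conj.tendsto' 0 0 (map_zero _)).comp hlim).mul hlim₁
    have h2 := ((continuous_im.tendsto _).comp h1).const_mul β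
    have h3 := (continuous_re.tendsto _).comp h1
    have h4 : Tendsto (fun x => h x * normSq (v x)) atTop (𝓝 0) := by
      refine bdd_le_mul_tendsto_zero' (2 * τ) ?_ ?_
      · filter_upwards [eventually_ge_atTop 0] with x hx using hbd x hx
      · exact (continuous_normSq.tendsto' 0 0 (map_zero _)).comp hlim
    have h5 := (h3.add h2).sub h4
    simpa using h5

/-! ### A priori bounds for the zeros of the secular function -/

theorem tendsto_exp_neg_mul_atTop {δ : ℝ} (hδ : 0 < δ) :
    Tendsto (fun x => Real.exp (-δ * x)) atTop (𝓝 0) :=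
  Real.tendsto_exp_atBot.comp (tendsto_id.const_mul_atTop_of_neg (neg_lt_zero.2 hδ))

theorem tendsto_airy_ray {a : ℂ} (ha : 0 < a.re) (ha' : |a.im| ≤ 3 / 5 * a.re) (b : ℂ) :
    Tendsto (fun x : ℝ => airy (a * x + b)) atTop (𝓝 0) :=
  (isBigO_airy_ray ha ha' b).trans_tendsto (tendsto_exp_neg_mul_atTop (half_pos ha))

theorem tendsto_deriv_airy_ray {a : ℂ} (ha : 0 < a.re) (ha' : |a.im| ≤ 3 / 5 * a.re) (b : ℂ) :
    Tendsto (fun x : ℝ => a * deriv airy (a * x + b)) atTop (𝓝 0) :=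
  (isBigO_deriv_airy_ray ha ha' b).trans_tendsto (tendsto_exp_neg_mul_atTop (half_pos ha))

theorem dir_sector_one : 0 < dir.re ∧ |dir.im| ≤ 3 / 5 * dir.re := by
  simpa using dir_sector one_pos

theorem isSolution_dir (z : ℂ) :
    IsSolution (fun x => I * x - z) (fun x => airy (dir * x + -z / dir ^ 2))
      (fun x => dir * deriv airy (dir * x + -z / dir ^ 2)) := by
  have h := isSolution_airy_ray dir (-z / dir ^ 2)
  have e : ∀ x : ℝ, dir ^ 2 * (dir * x + -z / dir ^ 2) = I * x - z := fun x => by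
    have := dir_ne_zero
    rw [← dir_cube]
    field_simp
    ring
  simpa only [e] using h

section Bounds

variable {s : ℝ} {z : ℂ}

theorem secular_boundary (h : secular s z = 0) :
    dir * deriv airy (dir * (0 : ℝ) + -z / dir ^ 2) =
      s * airy (dir * (0 : ℝ) + -z / dir ^ 2) := by
  rw [ofReal_zero, mul_zero, zero_add]
  exact sub_eq_zero.1 h

/-- If `Im z ≤ 0`, the imaginary part `x - Im z` of the potential would be positive for `x > 0`,
while the boundary form is real at `0`. -/
theorem im_pos_of_secular_eq_zero (h : secular s z = 0) : 0 < z.im := by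
  by_contra! hz
  obtain ⟨x, hx, hne⟩ := exists_airy_ray_ne_zero dir_ne_zero (-z / dir ^ 2)
  have h1 := (isSolution_dir z).im_mul_normSq_eq_zero
    (tendsto_airy_ray dir_sector_one.1 dir_sector_one.2 _)
    (tendsto_deriv_airy_ray dir_sector_one.1 dir_sector_one.2 _) ?_ 1 (fun y hy => ?_) hx
  · have h2 : (I * (x : ℂ) - z).im ≠ 0 := by
      simp
      linarith
    have h3 := normSq_eq_zero.not.2 hne
    simp_all
  · rw [secular_boundary h, mul_left_comm, ← normSq_eq_conj_mul_self]
    simp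
  · simp
    linarith

/-- Adding `τ³` times the imaginary part to the real part of the energy identity produces the real
Airy form `-d²/dx² + τ³ x`, bounded below by `19/20 τ²` through scaling. -/
theorem le_re_add_im_of_secular_eq_zero (hs : 0 ≤ s) (h : secular s z = 0) {τ : ℝ} (hτ : 0 < τ) :
    19 / 20 * τ ^ 2 ≤ z.re + τ ^ 3 * z.im := by
  by_contra! hz
  obtain ⟨x, hx, hne⟩ := exists_airy_ray_ne_zero dir_ne_zero (-z / dir ^ 2)
  refine hne ((isSolution_dir z).eq_zero_of_energy
    (tendsto_airy_ray dir_sector_one.1 dir_sector_one.2 _)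
    (tendsto_deriv_airy_ray dir_sector_one.1 dir_sector_one.2 _) hs (secular_boundary h)
    (τ ^ 3) hτ (fun y hy => ?_) hx)
  simp
  linarith

theorem le_re_of_secular_eq_zero (hs : 0 ≤ s) (h : secular s z = 0) {B : ℝ} (hB : z.im ≤ B) :
    1 / (10 * B ^ 2) ≤ z.re := by
  have hB0 : 0 < B := (im_pos_of_secular_eq_zero h).trans_le hB
  -- With `τ = 1/(2B)` the bound is `(19/80 - 1/8)/B² = (9/80)/B²`, which exceeds `1/(10 B²)`.
  have h1 := le_re_add_im_of_secular_eq_zero hs h (show 0 < 1 / (2 * B) by positivity)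
  have h2 : (1 / (2 * B)) ^ 3 * z.im ≤ (1 / (2 * B)) ^ 3 * B := by gcongr
  have h3 : (1 / (2 * B)) ^ 3 * B = 1 / 8 * (1 / B ^ 2) := by
    field_simp
    norm_num
  have h4 : (1 / (2 * B)) ^ 2 = 1 / 4 * (1 / B ^ 2) := by
    field_simp
    norm_num
  have h5 : 1 / (10 * B ^ 2) = 1 / 10 * (1 / B ^ 2) := by
    field_simp
  have h6 : 0 < 1 / B ^ 2 := by positivity
  rw [h4] at h1
  rw [h5]
  linarith

end Bounds

/-! ### The zeros of the derivative of the Airy function -/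

theorem isSolution_one (b : ℂ) :
    IsSolution (fun x => x + b) (fun x => airy (1 * x + b)) (fun x => 1 * deriv airy (1 * x + b)) := by
  have h := isSolution_airy_ray 1 b
  simpa only [one_pow, one_mul] using h

/-- Such a `b` gives a Neumann eigenfunction of the symmetric operator `-d²/dx² + x` with eigenvalue
`-b`; the sign of `β` handles both half-planes. -/
theorem im_eq_zero_of_deriv_airy_eq_zero {b : ℂ} (h : deriv airy b = 0) : b.im = 0 := by
  obtain ⟨x, hx, hne⟩ := exists_airy_ray_ne_zero one_ne_zero b
  have h3 := normSq_eq_zero.not.2 hne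
  have key : ∀ β : ℝ, 0 ≤ β * b.im → β * b.im = 0 := by
    intro β hβ
    have h1 := (isSolution_one b).im_mul_normSq_eq_zero
      (tendsto_airy_ray (by simp) (by norm_num) _)
      (tendsto_deriv_airy_ray (by simp) (by norm_num) _) (by simp [h]) β (fun y hy => by simpa) hx
    rw [← mul_assoc] at h1
    simpa using (mul_eq_zero.1 h1).resolve_right h3
  rcases le_total 0 b.im with hb | hb
  · simpa using key 1 (by simpa)
  · simpa using key (-1) (by simpa)

theorem re_le_of_deriv_airy_eq_zero {b : ℂ} (h : deriv airy b = 0) : b.re ≤ -(19 / 20) := by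
  by_contra! hb
  obtain ⟨x, hx, hne⟩ := exists_airy_ray_ne_zero one_ne_zero b
  refine hne ((isSolution_one b).eq_zero_of_energy (tendsto_airy_ray (by simp) (by norm_num) _)
    (tendsto_deriv_airy_ray (by simp) (by norm_num) _) le_rfl (by simp [h]) 0 one_pos
    (fun y hy => ?_) hx)
  simp
  linarith

/-- Here `f'' = -x f` with `f` increasing. Once `f(a) > 0`, `g` decreases at rate at least `f(a)`
and reaches `0`. If `f` is never positive, `g ≥ g(R)`, so `f` grows linearly and becomes positive.
-/
theorem not_pos_of_oscillation {f g : ℝ → ℝ} {R : ℝ} (hR : 1 ≤ R)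
    (hf : ∀ x, R ≤ x → HasDerivAt f (g x) x) (hg : ∀ x, R ≤ x → HasDerivAt g (-x * f x) x) :
    ¬ ∀ x, R ≤ x → 0 < g x := by
  intro hpos
  have hmono : ∀ a b, R ≤ a → a ≤ b → f a ≤ f b := fun a b ha hab => by
    simpa using add_mul_le_of_hasDerivAt (fun y hy => hf y (ha.trans hy))
      (fun y hy => (hpos y (ha.trans hy)).le) hab
  by_cases hex : ∃ a, R ≤ a ∧ 0 < f a
  · obtain ⟨a, ha, hfa⟩ := hex
    have h1 := add_mul_le_of_hasDerivAt (f := fun x => -g x) (c := f a)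
      (fun y hy => (hg y (ha.trans hy)).neg) (fun y hy => by
        have := hmono a y ha hy
        nlinarith [ha.trans hy]) (x := a + g a / f a)
      (by have := div_pos (hpos a ha) hfa; linarith)
    have h2 := hpos (a + g a / f a) (by have := div_pos (hpos a ha) hfa; linarith)
    rw [add_sub_cancel_left, mul_div_cancel₀ _ hfa.ne'] at h1
    linarith
  · push Not at hex
    have h1 := fun y (hy : R ≤ y) => add_mul_le_of_hasDerivAt (c := 0) hg (fun y hy => by
      nlinarith [hex y hy]) hy
    have hgR := hpos R le_rfl
    have hx : R ≤ R + (1 - f R) / g R := by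
      have := div_pos (show 0 < 1 - f R by linarith [hex R le_rfl]) hgR
      linarith
    have h2 := add_mul_le_of_hasDerivAt (c := g R) hf (fun y hy => by simpa using h1 y hy) hx
    rw [add_sub_cancel_left, mul_div_cancel₀ _ hgR.ne'] at h2
    linarith [hex _ hx]

theorem airy_ofReal_im (x : ℝ) : (airy x).im = 0 := by
  have h := airy_conj x
  rw [conj_ofReal] at h
  exact conj_eq_iff_im.1 h.symm

/-- The function `x ↦ Ai(-x)` solves `f'' = -x f`. Without zeros beyond `R` its derivative would
keep one sign, and the oscillation lemma applied to `f` or `-f` forbids this. -/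
theorem exists_deriv_airy_zero_gt (R : ℝ) : ∃ r : ℝ, R < r ∧ deriv airy (-r) = 0 := by
  have h1 : ∀ x : ℝ, HasDerivAt (fun x : ℝ => airy (-1 * x + 0)) (-deriv airy (-x)) x := fun x => by
    simpa using hasDerivAt_airy_ray (-1) 0 x
  have h2 : ∀ x : ℝ, HasDerivAt (fun x : ℝ => -1 * deriv airy (-1 * x + 0)) (-x * airy (-x)) x :=
    fun x => by simpa using hasDerivAt_deriv_airy_ray (-1) 0 x
  simp only [neg_mul, one_mul, add_zero] at h1 h2
  have hf : ∀ x : ℝ, HasDerivAt (fun x : ℝ => (airy (-x)).re) (-deriv airy (-x)).re x :=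
    fun x => reCLM.hasFDerivAt.comp_hasDerivAt x (h1 x)
  have hg : ∀ x : ℝ, HasDerivAt (fun x : ℝ => (-deriv airy (-x)).re) (-x * (airy (-x)).re) x :=
    fun x => (reCLM.hasFDerivAt.comp_hasDerivAt x (h2 x)).congr_deriv (by simp)
  have hi : ∀ x : ℝ, (-deriv airy (-x)).im = 0 := fun x => by
    have h3 : HasDerivAt (fun x : ℝ => (airy (-x)).im) (-deriv airy (-x)).im x :=
      imCLM.hasFDerivAt.comp_hasDerivAt x (h1 x)
    have h4 : (fun x : ℝ => (airy (-x)).im) = fun _ => 0 := by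
      ext y
      simpa using airy_ofReal_im (-y)
    rw [h4] at h3
    exact h3.unique (hasDerivAt_const x 0)
  by_contra! hne
  set S := max 1 (R + 1)
  have hne' : ∀ x ∈ Ici S, (-deriv airy (-x)).re ≠ 0 := fun x hx h0 => by
    have hRx : R < x := by
      have h5 : R + 1 ≤ S := le_max_right _ _
      have h6 : S ≤ x := hx
      linarith
    exact hne x hRx (neg_eq_zero.1 (Complex.ext h0 (hi x)))
  have hc : ContinuousOn (fun x : ℝ => (-deriv airy (-x)).re) (Ici S) := fun x _ =>
    (hg x).continuousAt.continuousWithinAt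
  by_cases hS : 0 < (-deriv airy (-S)).re
  · refine not_pos_of_oscillation (le_max_left 1 (R + 1)) (fun x _ => hf x) (fun x _ => hg x)
      fun x hx => ?_
    by_contra! hx0
    obtain ⟨y, hy, hy0⟩ := isPreconnected_Ici.intermediate_value hx (self_mem_Ici (a := S)) hc
      ⟨hx0, hS.le⟩
    exact hne' y hy hy0
  · refine not_pos_of_oscillation (le_max_left 1 (R + 1)) (fun x _ => (hf x).neg)
      (fun x _ => ((hg x).neg).congr_deriv (by simp)) fun x hx => ?_
    by_contra! hx0
    obtain ⟨y, hy, hy0⟩ := isPreconnected_Ici.intermediate_value (self_mem_Ici (a := S)) hx hc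
      ⟨not_lt.1 hS, by simpa using hx0⟩
    exact hne' y hy hy0

/-- An accumulation point would make `Ai'` vanish identically, and then `Ai'' = z Ai` would give `Ai
= 0` on the positive axis. -/
theorem finite_deriv_airy_zeros (R : ℝ) :
    ({r : ℝ | deriv airy (-r) = 0} ∩ Iic R).Finite := by
  by_contra hinf
  have hsub : {r : ℝ | deriv airy (-r) = 0} ∩ Iic R ⊆ Icc 0 R := fun r hr => by
    refine ⟨?_, hr.2⟩
    have := re_le_of_deriv_airy_eq_zero hr.1
    simp at this
    linarith
  obtain ⟨x, -, hx⟩ := Set.Infinite.exists_accPt_of_subset_isCompact hinf isCompact_Icc hsub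
  have hfr := accPt_iff_frequently_nhdsNE.1 hx
  have ht : Tendsto (fun r : ℝ => (-r : ℂ)) (𝓝[≠] x) (𝓝[≠] (-x : ℂ)) := by
    refine tendsto_nhdsWithin_iff.2 ⟨?_, ?_⟩
    · exact (continuous_ofReal.neg.tendsto x).mono_left nhdsWithin_le_nhds
    · filter_upwards [self_mem_nhdsWithin] with y hy
      simpa using hy
  have hz : deriv airy = fun _ => 0 := by
    refine AnalyticOnNhd.eq_of_frequently_eq (z₀ := (-x : ℂ))
      (fun z _ => differentiable_deriv_airy.analyticAt z) (fun z _ => analyticAt_const) ?_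
    exact ht.frequently (hfr.mono fun y hy => hy.1)
  obtain ⟨y, hy, hne⟩ := exists_airy_ray_ne_zero one_ne_zero 0
  have h1 := hasDerivAt_deriv_airy y
  rw [hz] at h1
  have h2 := h1.unique (hasDerivAt_const _ _)
  simp [hy.ne'] at h2
  simp [h2] at hne

theorem exists_strictMono_range_eq {S : Set ℝ} (hfin : ∀ R, (S ∩ Iic R).Finite)
    (hunb : ∀ R, ∃ x, R < x ∧ x ∈ S) : ∃ r : ℕ → ℝ, StrictMono r ∧ range r = S := by
  have hleast : ∀ T ⊆ S, T.Nonempty → ∃ x, IsLeast T x := by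
    rintro T hT ⟨y, hy⟩
    obtain ⟨x, hx⟩ := ((hfin y).subset (inter_subset_inter_left _ hT)).exists_minimal ⟨y, hy, self_mem_Iic⟩
    refine ⟨x, hx.1.1, fun t ht => ?_⟩
    by_contra! hlt
    exact absurd (hx.2 ⟨ht, hlt.le.trans hx.1.2⟩ hlt.le) (not_le.2 hlt)
  obtain ⟨x₀, hx₀⟩ := hleast S subset_rfl ((hunb 0).imp fun _ h => h.2)
  have hnext : ∀ R, ∃ x, IsLeast (S ∩ Ioi R) x := fun R =>
    hleast _ inter_subset_left ((hunb R).imp fun _ h => ⟨h.2, h.1⟩)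
  choose next hnext using hnext
  set r : ℕ → ℝ := fun n => Nat.rec x₀ (fun _ y => next y) n with hr
  have hsucc : ∀ n, r (n + 1) = next (r n) := fun n => rfl
  have hmono : StrictMono r := strictMono_nat_of_lt_succ fun n => (hnext (r n)).1.2
  have hmem : ∀ n, r n ∈ S := fun n => by
    cases n with
    | zero => exact hx₀.1
    | succ n => exact (hnext (r n)).1.1
  refine ⟨r, hmono, Subset.antisymm (range_subset_iff.2 hmem) fun x hx => ?_⟩
  by_contra hnot
  have hlt : ∀ n, r n < x := fun n => by
    refine lt_of_le_of_ne ?_ fun h => hnot ⟨n, h⟩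
    induction n with
    | zero => exact hx₀.2 hx
    | succ n ih =>
      exact (hnext (r n)).2 ⟨hx, lt_of_le_of_ne ih fun h => hnot ⟨n, h⟩⟩
  exact infinite_range_of_injective hmono.injective
    ((hfin x).subset (range_subset_iff.2 fun n => ⟨hmem n, (hlt n).le⟩))

end RobinAiry

namespace RobinAiry

open Complex ComplexConjugate
open scoped NNReal

/-! ### Global solutions of ordinary differential equations -/

theorem exists_global_solution {E : Type*} [NormedAddCommGroup E] [NormedSpace ℝ E]
    [CompleteSpace E] {f : ℝ → E → E} {K L : ℝ≥0} (hlip : ∀ t, LipschitzWith K (f t))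
    (hcont : ∀ x, Continuous fun t => f t x) (hL : ∀ t x, ‖f t x‖ ≤ L) (t₀ : ℝ) (x₀ : E) :
    ∃ z : ℝ → E, z t₀ = x₀ ∧ ∀ t, HasDerivAt z (f t (z t)) t := by
  have hloc : ∀ n : ℕ, ∃ α : ℝ → E, α t₀ = x₀ ∧
      ∀ t ∈ Icc (t₀ - (n + 1)) (t₀ + (n + 1)),
        HasDerivWithinAt α (f t (α t)) (Icc (t₀ - (n + 1)) (t₀ + (n + 1))) t := by
    intro n
    have hn : (0 : ℝ) ≤ n + 1 := by positivity
    have hP : IsPicardLindelof f (tmin := t₀ - (n + 1)) (tmax := t₀ + (n + 1))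
        -- The ball has radius speed times duration, so Picard–Lindelöf imposes no smallness on the
        -- interval.
        ⟨t₀, by constructor <;> linarith⟩ x₀ (L * (n + 1)) 0 L K :=
      { lipschitzOnWith := fun t _ => (hlip t).lipschitzOnWith
        continuousOn := fun x _ => (hcont x).continuousOn
        norm_le := fun t _ x _ => hL t x
        mul_max_le := by simp }
    exact hP.exists_eq_forall_mem_Icc_hasDerivWithinAt₀
  choose α hα0 hα using hloc
  have hαd : ∀ n : ℕ, ∀ t ∈ Ioo (t₀ - (n + 1)) (t₀ + (n + 1)),
      HasDerivAt (α n) (f t (α n t)) t := fun n t ht =>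
    (hα n t (Ioo_subset_Icc_self ht)).hasDerivAt (Icc_mem_nhds ht.1 ht.2)
  have huniq : ∀ n m : ℕ, n ≤ m →
      EqOn (α n) (α m) (Icc (t₀ - (n + 1)) (t₀ + (n + 1))) := by
    intro n m hnm
    have hnm' : (n : ℝ) ≤ m := by exact_mod_cast hnm
    have hn : (0 : ℝ) ≤ n := n.cast_nonneg
    have hsub : Icc (t₀ - (n + 1)) (t₀ + (n + 1)) ⊆ Icc (t₀ - (m + 1)) (t₀ + (m + 1)) :=
      Icc_subset_Icc (by linarith) (by linarith)
    refine ODE_solution_unique_of_mem_Icc (v := f) (s := fun _ => univ) (t₀ := t₀)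
      (fun t _ => (hlip t).lipschitzOnWith) ⟨by linarith, by linarith⟩
      (fun t ht => (hα n t ht).continuousWithinAt) (hαd n) (fun _ _ => mem_univ _)
      (fun t ht => ((hα m t (hsub ht)).continuousWithinAt).mono hsub)
      (fun t ht => hαd m t ⟨by linarith [ht.1], by linarith [ht.2]⟩) (fun _ _ => mem_univ _)
      (by rw [hα0, hα0])
  -- Piece `n` lives on radius `n + 1`, so `t` is interior to its piece; one more step, `M`, covers
  -- a neighbourhood of `t` with a single piece.
  refine ⟨fun t => α ⌈|t - t₀|⌉₊ t, by simp [hα0], fun t => ?_⟩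
  set M := ⌈|t - t₀|⌉₊ + 1 with hM
  have hval : ∀ y : ℝ, |y - t₀| < |t - t₀| + 1 → α ⌈|y - t₀|⌉₊ y = α M y := by
    intro y hy
    refine huniq _ _ (Nat.ceil_le.2 ?_) ?_
    · rw [hM]
      push_cast
      linarith [Nat.le_ceil |t - t₀|]
    · have := abs_le.1 (Nat.le_ceil |y - t₀|)
      constructor <;> linarith [this.1, this.2]
  have hnear : ∀ᶠ y in 𝓝 t, |y - t₀| < |t - t₀| + 1 :=
    (by fun_prop : Continuous fun y => |y - t₀|).continuousAt.eventually_lt continuousAt_const (by simp)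
  have hd : HasDerivAt (α M) (f t (α M t)) t := by
    refine hαd M t ?_
    have := abs_le.1 (Nat.le_ceil |t - t₀|)
    rw [hM]
    push_cast
    constructor <;> linarith [this.1, this.2]
  simp only [hval t (by linarith)]
  exact hd.congr_of_eventuallyEq (hnear.mono fun y hy => hval y hy)

theorem eq_mul_exp_of_hasDerivAt {y k : ℝ → ℂ} {a b : ℝ} (hab : a ≤ b) (hk : Continuous k)
    (hy : ∀ s ∈ Icc a b, HasDerivAt y (k s * y s) s) :
    y b = y a * exp (∫ s in a..b, k s) := by
  have hJ : ∀ s, HasDerivAt (fun s => ∫ t in a..s, k t) (k s) s := fun s =>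
    (hk.integral_hasStrictDerivAt a s).hasDerivAt
  have hd : ∀ s ∈ Icc a b, HasDerivAt (fun s => y s * exp (-∫ t in a..s, k t)) 0 s := by
    intro s hs
    refine ((hy s hs).mul (hJ s).neg.cexp).congr_deriv ?_
    ring
  have h := constant_of_has_deriv_right_zero
    (fun s hs => (hd s hs).continuousAt.continuousWithinAt)
    (fun s hs => (hd s (Ico_subset_Icc_self hs)).hasDerivWithinAt) b ⟨hab, le_rfl⟩
  simp only [intervalIntegral.integral_same, neg_zero, exp_zero, mul_one] at h
  rw [← h, mul_assoc, ← exp_add, neg_add_cancel, exp_zero, mul_one]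

/-! ### The flow of the eigenvalue equation `μ' = i / (μ + s²)` -/

/-- Truncation of the real part from below. -/
noncomputable def clampRe (c : ℝ) (z : ℂ) : ℂ := ⟨max z.re c, z.im⟩

@[simp] theorem clampRe_re (c : ℝ) (z : ℂ) : (clampRe c z).re = max z.re c := rfl

@[simp] theorem clampRe_im (c : ℝ) (z : ℂ) : (clampRe c z).im = z.im := rfl

theorem clampRe_of_le {c : ℝ} {z : ℂ} (h : c ≤ z.re) : clampRe c z = z :=
  Complex.ext (max_eq_left h) rfl

theorem norm_clampRe_sub_le (c : ℝ) (z w : ℂ) : ‖clampRe c z - clampRe c w‖ ≤ ‖z - w‖ := by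
  rw [Complex.norm_def, Complex.norm_def]
  refine Real.sqrt_le_sqrt ?_
  rw [normSq_apply, normSq_apply]
  simp only [sub_re, sub_im, clampRe_re, clampRe_im]
  have h := abs_max_sub_max_le_abs z.re w.re c
  have := mul_self_le_mul_self (abs_nonneg _) h
  rw [abs_mul_abs_self, abs_mul_abs_self] at this
  linarith

theorem continuous_clampRe (c : ℝ) : Continuous (clampRe c) :=
  (LipschitzWith.of_dist_le_mul (K := 1) fun z w => by
    simpa [dist_eq_norm] using norm_clampRe_sub_le c z w).continuous

/-- Truncation keeps the denominator away from `0`, which makes the field bounded and globally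
Lipschitz. It is inactive where the real part is at least `c`. -/
theorem le_norm_clampRe_add (c : ℝ) (z : ℂ) (s : ℝ) : c ≤ ‖clampRe c z + (s : ℂ) ^ 2‖ := by
  refine le_trans ?_ (re_le_norm _)
  rw [← ofReal_pow, add_re, ofReal_re, clampRe_re]
  linarith [le_max_right z.re c, sq_nonneg s]

theorem clampRe_add_ne_zero {c : ℝ} (hc : 0 < c) (z : ℂ) (s : ℝ) :
    clampRe c z + (s : ℂ) ^ 2 ≠ 0 :=
  norm_pos_iff.1 (hc.trans_le (le_norm_clampRe_add c z s))

/-- `z` solves the eigenvalue equation with truncated right-hand side. -/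
def IsFlow (c : ℝ) (z : ℝ → ℂ) : Prop :=
  ∀ s, HasDerivAt z (I / (clampRe c (z s) + (s : ℂ) ^ 2)) s

theorem norm_flow_le {c : ℝ} (hc : 0 < c) (z : ℂ) (s : ℝ) :
    ‖I / (clampRe c z + (s : ℂ) ^ 2)‖ ≤ 1 / c := by
  rw [norm_div, norm_I]
  exact one_div_le_one_div_of_le hc (le_norm_clampRe_add c z s)

theorem lipschitzWith_flow {c : ℝ} (hc : 0 < c) (s : ℝ) :
    LipschitzWith (Real.toNNReal (1 / c ^ 2))
      (fun z => I / (clampRe c z + (s : ℂ) ^ 2)) := by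
  refine LipschitzWith.of_dist_le_mul fun z w => ?_
  rw [Real.coe_toNNReal _ (by positivity), dist_eq_norm, dist_eq_norm]
  have hz := clampRe_add_ne_zero hc z s
  have hw := clampRe_add_ne_zero hc w s
  rw [div_sub_div _ _ hz hw, norm_div, norm_mul, div_le_iff₀ (by positivity)]
  have e : I * (clampRe c w + (s : ℂ) ^ 2) - (clampRe c z + (s : ℂ) ^ 2) * I =
      I * (clampRe c w - clampRe c z) := by ring
  rw [e, norm_mul, norm_I, one_mul, norm_sub_rev]
  have h1 := le_norm_clampRe_add c z s
  have h2 := le_norm_clampRe_add c w s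
  have h3 : c ^ 2 ≤ ‖clampRe c z + (s : ℂ) ^ 2‖ * ‖clampRe c w + (s : ℂ) ^ 2‖ := by
    rw [sq]
    gcongr
  calc _ ≤ ‖z - w‖ := norm_clampRe_sub_le c z w
    _ = 1 / c ^ 2 * ‖z - w‖ * c ^ 2 := by field_simp
    _ ≤ _ := by gcongr

theorem exists_isFlow {c : ℝ} (hc : 0 < c) (s₀ : ℝ) (z₀ : ℂ) :
    ∃ z : ℝ → ℂ, z s₀ = z₀ ∧ IsFlow c z := by
  refine exists_global_solution (L := Real.toNNReal (1 / c)) (lipschitzWith_flow hc)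
    (fun z => ?_) (fun s z => ?_) s₀ z₀
  · exact Continuous.div continuous_const (by fun_prop) fun s => clampRe_add_ne_zero hc z s
  · rw [Real.coe_toNNReal _ (by positivity)]
    exact norm_flow_le hc z s

theorem I_div_re (w : ℂ) : (I / w).re = w.im / normSq w := by
  simp [div_re]

theorem I_div_im (w : ℂ) : (I / w).im = w.re / normSq w := by
  simp [div_im]

section Flow

variable {c : ℝ} {z : ℝ → ℂ}

theorem IsFlow.continuous (hz : IsFlow c z) : Continuous z :=
  continuous_iff_continuousAt.2 fun s => (hz s).continuousAt

theorem IsFlow.hasDerivAt_re (hz : IsFlow c z) (s : ℝ) :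
    HasDerivAt (fun s => (z s).re) ((z s).im / normSq (clampRe c (z s) + (s : ℂ) ^ 2)) s := by
  refine (reCLM.hasFDerivAt.comp_hasDerivAt s (hz s)).congr_deriv ?_
  rw [reCLM_apply, I_div_re, ← ofReal_pow, add_im, ofReal_im, add_zero, clampRe_im]

theorem IsFlow.hasDerivAt_im (hz : IsFlow c z) (s : ℝ) :
    HasDerivAt (fun s => (z s).im)
      ((max (z s).re c + s ^ 2) / normSq (clampRe c (z s) + (s : ℂ) ^ 2)) s := by
  refine (imCLM.hasFDerivAt.comp_hasDerivAt s (hz s)).congr_deriv ?_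
  rw [imCLM_apply, I_div_im, ← ofReal_pow, add_re, ofReal_re, clampRe_re]

theorem IsFlow.im_mono (hc : 0 < c) (hz : IsFlow c z) {a b : ℝ} (hab : a ≤ b) :
    (z a).im ≤ (z b).im := by
  have h := add_mul_le_of_hasDerivAt (c := 0) (fun s _ => hz.hasDerivAt_im s) (fun s _ =>
    div_nonneg (by positivity) (normSq_nonneg _)) hab
  simpa using h

theorem IsFlow.re_mono (hc : 0 < c) (hz : IsFlow c z) {a b : ℝ} (ha : 0 ≤ (z a).im)
    (hab : a ≤ b) : (z a).re ≤ (z b).re := by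
  simpa using add_mul_le_of_hasDerivAt (fun s _ => hz.hasDerivAt_re s) (fun s hs =>
    div_nonneg (ha.trans (hz.im_mono hc hs)) (normSq_nonneg _)) hab

/-- This is where the flow comes from: by `Ai'' = b Ai` and `dir³ = I`, the derivative along it is a
multiple of the secular function itself, so its zero set is transported. -/
theorem hasDerivAt_secular {s : ℝ} (hz : HasDerivAt z (I / (z s + (s : ℂ) ^ 2)) s)
    (hne : z s + (s : ℂ) ^ 2 ≠ 0) :
    HasDerivAt (fun s => secular s (z s)) (s / (z s + (s : ℂ) ^ 2) * secular s (z s)) s := by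
  unfold secular
  have hd := dir_ne_zero
  have hb : HasDerivAt (fun s => -z s / dir ^ 2) (-(I / (z s + (s : ℂ) ^ 2)) / dir ^ 2) s :=
    hz.neg.div_const _
  have h1 := ((hasDerivAt_deriv_airy _).comp s hb).const_mul dir
  have h2 := (ofRealCLM.hasDerivAt (x := s)).mul ((hasDerivAt_airy _).comp s hb)
  refine (h1.sub h2).congr_deriv ?_
  simp only [ofRealCLM_apply, Function.comp, ofReal_one, one_mul]
  rw [← dir_cube]
  field_simp
  ring

theorem IsFlow.secular_eq (hc : 0 < c) (hz : IsFlow c z) {a b : ℝ} (hab : a ≤ b)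
    (hre : ∀ s ∈ Icc a b, c ≤ (z s).re) :
    secular b (z b) = secular a (z a) *
      exp (∫ s in a..b, (s : ℂ) / (clampRe c (z s) + (s : ℂ) ^ 2)) := by
  refine eq_mul_exp_of_hasDerivAt (y := fun s => secular s (z s)) hab ?_ fun s hs => ?_
  · have := (continuous_clampRe c).comp hz.continuous
    exact Continuous.div (by fun_prop) (by fun_prop) fun s => clampRe_add_ne_zero hc _ s
  · have h := hz s
    have hne := clampRe_add_ne_zero hc (z s) s
    rw [clampRe_of_le (hre s hs)] at h hne ⊢
    exact hasDerivAt_secular h hne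

theorem IsFlow.secular_eq_zero_iff (hc : 0 < c) (hz : IsFlow c z) {a b : ℝ} (hab : a ≤ b)
    (hre : ∀ s ∈ Icc a b, c ≤ (z s).re) : secular b (z b) = 0 ↔ secular a (z a) = 0 := by
  rw [hz.secular_eq hc hab hre, mul_eq_zero, or_iff_left (exp_ne_zero _)]

end Flow

theorem secular_zero_iff (z : ℂ) :
    secular 0 z = 0 ↔ ∃ r : ℝ, deriv airy (-r) = 0 ∧ z = r * dir ^ 2 := by
  have hd := dir_ne_zero
  have e : secular 0 z = 0 ↔ deriv airy (-z / dir ^ 2) = 0 := by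
    simp [secular, hd]
  rw [e]
  constructor
  · intro h
    have hi := im_eq_zero_of_deriv_airy_eq_zero h
    have hr : -z / dir ^ 2 = ((-z / dir ^ 2).re : ℂ) := Complex.ext (by simp) (by simpa using hi)
    refine ⟨-(-z / dir ^ 2).re, ?_, ?_⟩
    · rw [ofReal_neg, neg_neg, ← hr, h]
    · rw [ofReal_neg, ← hr]
      field_simp
  · rintro ⟨r, hr, rfl⟩
    rw [← hr]
    congr 1
    field_simp

theorem le_of_deriv_airy_neg_eq_zero {r : ℝ} (h : deriv airy (-r) = 0) : 19 / 20 ≤ r := by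
  have := re_le_of_deriv_airy_eq_zero h
  simp at this
  linarith

theorem ofReal_mul_dir_sq_re (r : ℝ) : ((r : ℂ) * dir ^ 2).re = r / 2 := by
  rw [re_ofReal_mul, dir_sq]
  ring

theorem ofReal_mul_dir_sq_im (r : ℝ) : ((r : ℂ) * dir ^ 2).im = r * (Real.sqrt 3 / 2) := by
  rw [im_ofReal_mul, dir_sq]

/-- Every eigenvalue for the parameter `s₀` is reached by the flow from an eigenvalue for the
parameter `0`. -/
theorem exists_isFlow_of_secular_eq_zero {s₀ : ℝ} (hs₀ : 0 ≤ s₀) {z₀ : ℂ}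
    (h : secular s₀ z₀ = 0) :
    ∃ c z, 0 < c ∧ IsFlow c z ∧ z s₀ = z₀ ∧ (∀ s ∈ Icc 0 s₀, c ≤ (z s).re) ∧
      secular 0 (z 0) = 0 := by
  set B := z₀.im with hB
  have hBpos : 0 < B := im_pos_of_secular_eq_zero h
  -- Half of the a priori bound at height `B`. Going backwards `Im z` does not increase, so the same
  -- bound holds for every zero met on the way.
  set c := 1 / (10 * B ^ 2) / 2 with hc
  have hcpos : 0 < c := by positivity
  have hclt : c < 1 / (10 * B ^ 2) := half_lt_self (by positivity)
  obtain ⟨z, hz0, hz⟩ := exists_isFlow hcpos s₀ z₀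
  have key : ∀ s ∈ Icc 0 s₀, c < (z s).re := by
    by_contra! hex
    obtain ⟨s, hs, hsc⟩ := hex
    have hcont : Continuous fun s => (z s).re := continuous_re.comp hz.continuous
    have hcpt : IsCompact (Icc 0 s₀ ∩ {s | (z s).re ≤ c}) :=
      isCompact_Icc.inter_right (isClosed_le hcont continuous_const)
    -- At the last parameter where the truncation level is met, the curve is still a zero of the
    -- secular function, against the a priori bound.
    obtain ⟨s₁, ⟨hs₁, hs₁c⟩, hmax⟩ := hcpt.exists_isGreatest ⟨s, hs, hsc⟩
    have hs₁c : (z s₁).re ≤ c := hs₁c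
    have hgt : ∀ t ∈ Ioc s₁ s₀, c < (z t).re := fun t ht => by
      by_contra! hle
      exact absurd (hmax ⟨⟨hs₁.1.trans ht.1.le, ht.2⟩, hle⟩) (not_le.2 ht.1)
    have hlt : s₁ < s₀ := by
      refine lt_of_le_of_ne hs₁.2 fun heq => ?_
      have := le_re_of_secular_eq_zero hs₀ h le_rfl
      rw [heq, hz0] at hs₁c
      linarith
    have hge : c ≤ (z s₁).re := by
      refine ge_of_tendsto (hcont.continuousAt.mono_left (nhdsWithin_le_nhds (s := Ioi s₁))) ?_
      filter_upwards [Ioc_mem_nhdsGT hlt] with t ht using (hgt t ht).le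
    have hsec : secular s₁ (z s₁) = 0 := by
      rw [← hz.secular_eq_zero_iff hcpos hs₁.2, hz0, h]
      intro t ht
      rcases eq_or_lt_of_le ht.1 with rfl | hlt
      · exact hge
      · exact (hgt t ⟨hlt, ht.2⟩).le
    have := le_re_of_secular_eq_zero hs₁.1 hsec (B := B) (by
      rw [hB, ← hz0]
      exact hz.im_mono hcpos hs₁.2)
    linarith
  refine ⟨c, z, hcpos, hz, hz0, fun s hs => (key s hs).le, ?_⟩
  rw [← hz.secular_eq_zero_iff hcpos hs₀ fun s hs => (key s hs).le, hz0, h]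

/-! ### Separation of the real parts -/

/-- With `X = Re w Re w'` and `Y = Im w Im w'`, `|w w'|² ≥ (X + Y)²`, and `(X + Y)² - 8X(Y - X) =
(3X - Y)²`. The constant is attained at `w = w'` of argument `π/3`. -/
theorem neg_re_inv_mul_le {w w' : ℂ} (hw : 0 < w.re) (hw' : 0 < w'.re) :
    -(1 / (w * w')).re ≤ 1 / (8 * (w.re * w'.re)) := by
  have hn : 0 < normSq (w * w') := normSq_pos.2 (mul_ne_zero
    (fun h => by simp [h] at hw) (fun h => by simp [h] at hw'))
  have e : -(1 / (w * w')).re = (w.im * w'.im - w.re * w'.re) / normSq (w * w') := by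
    simp
    ring
  have hp : 0 < w.re * w'.re := mul_pos hw hw'
  rw [e, div_le_div_iff₀ hn (by positivity), normSq_mul, normSq_apply, normSq_apply]
  nlinarith [sq_nonneg (3 * (w.re * w'.re) - w.im * w'.im),
    sq_nonneg (w.re * w'.im - w.im * w'.re)]

theorem hasDerivAt_arctan_primitive {α : ℝ} (hα : 0 < α) (s : ℝ) :
    HasDerivAt (fun s => s / (2 * α ^ 2 * (α ^ 2 + s ^ 2)) + Real.arctan (s / α) / (2 * α ^ 3))
      (1 / (α ^ 2 + s ^ 2) ^ 2) s := by
  have h0 : HasDerivAt (fun s => 2 * α ^ 2 * (α ^ 2 + s ^ 2)) (2 * α ^ 2 * (2 * s)) s := by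
    simpa using (((hasDerivAt_id s).pow 2).const_add (α ^ 2)).const_mul (2 * α ^ 2)
  have hpos : 0 < α ^ 2 + s ^ 2 := by positivity
  have h1 := (hasDerivAt_id s).div h0 (by positivity)
  have h2 := (((hasDerivAt_id s).div_const α).arctan).div_const (2 * α ^ 3)
  refine (h1.add h2).congr_deriv ?_
  have h3 : 1 + (s / α) ^ 2 = (α ^ 2 + s ^ 2) / α ^ 2 := by field_simp
  simp only [id]
  rw [h3]
  field_simp
  ring

/-- The left side is the bound on the upward phase drift. The value `13/20` is admissible because
`(13/20)² < 19/40`, and it is large enough for `(1 + π)/(32 (13/20)³) < π/6`. -/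
theorem arctan_primitive_lt (s : ℝ) :
    1 / 8 * (s / (2 * (13 / 20) ^ 2 * ((13 / 20) ^ 2 + s ^ 2)) +
      Real.arctan (s / (13 / 20)) / (2 * (13 / 20) ^ 3)) < Real.pi / 6 := by
  have h1 := Real.arctan_lt_pi_div_two (s / (13 / 20))
  have h2 : s / (2 * (13 / 20) ^ 2 * ((13 / 20) ^ 2 + s ^ 2)) ≤ 1 / (4 * (13 / 20) ^ 3) := by
    rw [div_le_div_iff₀ (by positivity) (by norm_num)]
    nlinarith [sq_nonneg (s - 13 / 20)]
  have h3 := Real.pi_gt_three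
  generalize s / (2 * (13 / 20) ^ 2 * ((13 / 20) ^ 2 + s ^ 2)) = A at *
  generalize Real.arctan (s / (13 / 20)) = B at *
  norm_num at *
  linarith

/-- The difference `D` of the curves solves `D' = -i D/(W W')`, so its argument is `π/3 + J(s)` with
`J = Im ∫ k`. The real part stays positive while `-5π/6 < J < π/6`. -/
theorem IsFlow.re_sub_pos {z z' : ℝ → ℂ} (hz : IsFlow (19 / 40) z) (hz' : IsFlow (19 / 40) z')
    {r r' : ℝ} (hr : 19 / 20 ≤ r) (hrr : r < r') (h0 : z 0 = r * dir ^ 2)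
    (h0' : z' 0 = r' * dir ^ 2) {s : ℝ} (hs : 0 ≤ s) : (z s).re < (z' s).re := by
  have hc : (0 : ℝ) < 19 / 40 := by norm_num
  have h3 := Real.sq_sqrt (show (0 : ℝ) ≤ 3 by norm_num)
  set W : ℝ → ℂ := fun s => clampRe (19 / 40) (z s) + (s : ℂ) ^ 2 with hW
  set W' : ℝ → ℂ := fun s => clampRe (19 / 40) (z' s) + (s : ℂ) ^ 2 with hW'
  have hWne : ∀ s, W s ≠ 0 := fun s => clampRe_add_ne_zero hc _ s
  have hWne' : ∀ s, W' s ≠ 0 := fun s => clampRe_add_ne_zero hc _ s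
  have hsqrt : 0 < Real.sqrt 3 := by positivity
  have bound : ∀ {y : ℝ → ℂ} {ρ : ℝ}, IsFlow (19 / 40) y → 19 / 20 ≤ ρ → y 0 = ρ * dir ^ 2 →
      ∀ s, 0 ≤ s → 19 / 40 ≤ (y s).re ∧ 19 / 20 * (Real.sqrt 3 / 2) ≤ (y s).im := by
    intro y ρ hy hρ hy0 s hs
    have hi : (y 0).im = ρ * (Real.sqrt 3 / 2) := by rw [hy0, ofReal_mul_dir_sq_im]
    have hre : (y 0).re = ρ / 2 := by rw [hy0, ofReal_mul_dir_sq_re]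
    have h1 := hy.im_mono hc hs
    have h2 := hy.re_mono hc (a := 0) (by rw [hi]; positivity) hs
    refine ⟨by linarith, le_trans ?_ h1⟩
    rw [hi]
    gcongr
  have hb := bound hz hr h0
  have hb' := bound hz' (hr.trans hrr.le) h0'
  have Wre : ∀ {y : ℝ → ℂ} {s : ℝ}, 19 / 40 ≤ (y s).re →
      (clampRe (19 / 40) (y s) + (s : ℂ) ^ 2).re = (y s).re + s ^ 2 := by
    intro y s h
    rw [clampRe_of_le h, ← ofReal_pow, add_re, ofReal_re]
  -- The initial angle `π/3` gives `|W|² ≥ (19/20)² + 19/20 s² + s⁴`. Hence `|k| ≤ (5/4)/(1 + s²)`,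
  -- whose integral stays below `5π/8`.
  have Wnorm : ∀ {y : ℝ → ℂ} {s : ℝ}, 19 / 40 ≤ (y s).re → 19 / 20 * (Real.sqrt 3 / 2) ≤ (y s).im →
      4 / 5 * (1 + s ^ 2) ≤ ‖clampRe (19 / 40) (y s) + (s : ℂ) ^ 2‖ ^ 2 := by
    intro y s h1 h2
    rw [← normSq_eq_norm_sq, normSq_apply, Wre h1, ← ofReal_pow, add_im, ofReal_im, add_zero,
      clampRe_im]
    have h5 : (19 / 40 + s ^ 2) * (19 / 40 + s ^ 2) ≤ ((y s).re + s ^ 2) * ((y s).re + s ^ 2) := by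
      gcongr
    have h6 := mul_self_le_mul_self (by positivity) h2
    nlinarith [sq_nonneg (s ^ 2), sq_nonneg s]
  set k : ℝ → ℂ := fun s => -(I * (1 / (W s * W' s))) with hk
  have hkc : Continuous k := by
    have h1 := (continuous_clampRe (19 / 40)).comp hz.continuous
    have h2 := (continuous_clampRe (19 / 40)).comp hz'.continuous
    exact (continuous_const.mul (Continuous.div continuous_const (by fun_prop)
      fun s => mul_ne_zero (hWne s) (hWne' s))).neg
  have hkim : ∀ s, (k s).im = -(1 / (W s * W' s)).re := fun s => by
    rw [hk, neg_im, I_mul_im]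
  have hd : z' s - z s = (z' 0 - z 0) * exp (∫ t in (0 : ℝ)..s, k t) := by
    refine eq_mul_exp_of_hasDerivAt (y := fun s => z' s - z s) hs hkc fun t ht => ?_
    refine ((hz' t).sub (hz t)).congr_deriv ?_
    have e : z' t - z t = W' t - W t := by
      rw [hW, hW']
      simp only
      rw [clampRe_of_le (hb t ht.1).1, clampRe_of_le (hb' t ht.1).1]
      ring
    rw [e, hk]
    have h1 := hWne t
    have h2 := hWne' t
    change I / W' t - I / W t = _
    field_simp
    ring
  set J : ℝ → ℝ := fun s => (∫ t in (0 : ℝ)..s, k t).im with hJ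
  have hJd : ∀ s, HasDerivAt J (k s).im s := fun s =>
    imCLM.hasFDerivAt.comp_hasDerivAt s (hkc.integral_hasStrictDerivAt 0 s).hasDerivAt
  have hJ0 : J 0 = 0 := by simp [hJ]
  have hup : J s < Real.pi / 6 := by
    have h1 := add_mul_le_of_hasDerivAt (c := 0) (x := s)
      (fun t (_ : 0 ≤ t) => ((hasDerivAt_arctan_primitive (α := 13 / 20) (by norm_num) t).const_mul
        (1 / 8)).sub (hJd t)) (fun t ht => ?_) hs
    · simp [hJ0] at h1
      rw [← one_div] at h1
      exact h1.trans_lt (arctan_primitive_lt s)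
    · rw [hkim, sub_nonneg]
      have e := Wre (hb t ht).1
      have e' := Wre (hb' t ht).1
      have p1 : (13 / 20) ^ 2 + t ^ 2 ≤ (W t).re := by
        rw [hW]
        simp only
        rw [e]
        linarith [(hb t ht).1]
      have p2 : (13 / 20) ^ 2 + t ^ 2 ≤ (W' t).re := by
        rw [hW']
        simp only
        rw [e']
        linarith [(hb' t ht).1]
      have p0 : 0 < (13 / 20 : ℝ) ^ 2 + t ^ 2 := by positivity
      refine (neg_re_inv_mul_le (p0.trans_le p1) (p0.trans_le p2)).trans ?_
      rw [div_mul_div_comm, one_mul]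
      refine one_div_le_one_div_of_le (by positivity) ?_
      rw [sq]
      exact mul_le_mul_of_nonneg_left (mul_le_mul p1 p2 p0.le (p0.le.trans p1)) (by norm_num)
  have hlow : -(5 * Real.pi / 6) < J s := by
    have h1 := add_mul_le_of_hasDerivAt (c := 0) (x := s)
      (fun t (_ : 0 ≤ t) => (((Real.hasDerivAt_arctan t).const_mul (5 / 4)).add (hJd t)))
      (fun t ht => ?_) hs
    · simp [hJ0] at h1
      linarith [Real.arctan_lt_pi_div_two s, Real.pi_pos]
    · have q1 := Wnorm (hb t ht).1 (hb t ht).2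
      have q2 := Wnorm (hb' t ht).1 (hb' t ht).2
      have q3 : ‖k t‖ ≤ 5 / 4 * (1 / (1 + t ^ 2)) := by
        rw [hk, norm_neg, norm_mul, norm_I, one_mul, norm_div, norm_one, norm_mul,
          div_mul_div_comm, div_le_div_iff₀ (mul_pos (norm_pos_iff.2 (hWne t))
            (norm_pos_iff.2 (hWne' t))) (by positivity)]
        have q4 : 4 / 5 * (1 + t ^ 2) ≤ ‖W t‖ * ‖W' t‖ := by
          refine (pow_le_pow_iff_left₀ (by positivity) (by positivity) two_ne_zero).1 ?_
          rw [mul_pow ‖W t‖, sq (4 / 5 * (1 + t ^ 2))]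
          gcongr
        linarith
      have q5 := (abs_le.1 ((abs_im_le_norm (k t)).trans q3)).1
      linarith
  have hre : (z' s - z s).re = (r' - r) * (Real.exp (∫ t in (0 : ℝ)..s, k t).re *
      Real.cos (Real.pi / 3 + J s)) := by
    rw [hd, h0, h0', ← sub_mul, ← ofReal_sub, mul_assoc, re_ofReal_mul, mul_re, exp_re, exp_im,
      dir_sq, Real.cos_add, Real.cos_pi_div_three, Real.sin_pi_div_three]
    ring
  have hcos : 0 < Real.cos (Real.pi / 3 + J s) :=
    Real.cos_pos_of_mem_Ioo ⟨by linarith, by linarith⟩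
  have hfin : 0 < (z' s - z s).re := by
    rw [hre]
    exact mul_pos (sub_pos.2 hrr) (mul_pos (Real.exp_pos _) hcos)
  rw [sub_re] at hfin
  linarith

/-- The zeros of the secular functions form a sequence of curves, ordered by the real part. -/
theorem exists_eigenvalue_curves :
    ∃ μ : ℕ → ℝ → ℂ,
      (∀ n s, 0 ≤ s → HasDerivAt (μ n) (I / (μ n s + (s : ℂ) ^ 2)) s) ∧
      (∀ n s, 0 ≤ s → 19 / 40 ≤ (μ n s).re ∧ 0 < (μ n s).im) ∧
      (∀ s, 0 ≤ s → StrictMono fun n => (μ n s).re) ∧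
      ∀ s, 0 ≤ s → ∀ z, secular s z = 0 ↔ ∃ n, μ n s = z := by
  have hc : (0 : ℝ) < 19 / 40 := by norm_num
  obtain ⟨r, hmono, hrange⟩ := exists_strictMono_range_eq finite_deriv_airy_zeros
    exists_deriv_airy_zero_gt
  have hr0 : ∀ n, deriv airy (-r n) = 0 := fun n => by
    have : r n ∈ range r := mem_range_self n
    rwa [hrange] at this
  have hr : ∀ n, 19 / 20 ≤ r n := fun n => le_of_deriv_airy_neg_eq_zero (hr0 n)
  choose μ hμ0 hμ using fun n => exists_isFlow hc 0 ((r n : ℂ) * dir ^ 2)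
  have him0 : ∀ n, 0 < (μ n 0).im := fun n => by
    rw [hμ0, ofReal_mul_dir_sq_im]
    have := hr n
    positivity
  have hre : ∀ n s, 0 ≤ s → 19 / 40 ≤ (μ n s).re := fun n s hs => by
    have h1 := (hμ n).re_mono hc (him0 n).le hs
    rw [hμ0, ofReal_mul_dir_sq_re] at h1
    linarith [hr n]
  refine ⟨μ, fun n s hs => ?_, fun n s hs => ⟨hre n s hs, ?_⟩, fun s hs n m hnm => ?_,
    fun s hs z => ⟨fun h => ?_, ?_⟩⟩
  · have h := hμ n s
    rwa [clampRe_of_le (hre n s hs)] at h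
  · exact (him0 n).trans_le ((hμ n).im_mono hc hs)
  · exact (hμ n).re_sub_pos (hμ m) (hr n) (hmono hnm) (hμ0 n) (hμ0 m) hs
  · obtain ⟨c, y, hcpos, hy, hys, hyc, hy0⟩ := exists_isFlow_of_secular_eq_zero hs h
    obtain ⟨ρ, hρ, hyρ⟩ := (secular_zero_iff _).1 hy0
    obtain ⟨n, rfl⟩ : ρ ∈ range r := by rwa [hrange]
    refine ⟨n, ?_⟩
    rw [← hys]
    -- The backward curve has its own truncation level `c`. Its real part is also at least `19/40`,
    -- so both truncations are inactive and uniqueness identifies it with `μ n`.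
    have hyre : ∀ t ∈ Icc 0 s, 19 / 40 ≤ (y t).re := fun t ht => by
      have h1 := hy.re_mono hcpos (a := 0) (by rw [hyρ, ← hμ0]; exact (him0 n).le) ht.1
      rw [hyρ, ofReal_mul_dir_sq_re] at h1
      linarith [hr n]
    refine ODE_solution_unique (lipschitzWith_flow hc) (hμ n).continuous.continuousOn
      (fun t _ => (hμ n t).hasDerivWithinAt) hy.continuous.continuousOn (fun t ht => ?_)
      (by rw [hμ0, hyρ]) ⟨hs, le_rfl⟩
    have ht' := Ico_subset_Icc_self ht
    have h1 := (hy t).hasDerivWithinAt (s := Ici t)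
    rwa [clampRe_of_le (hyc t ht'), ← clampRe_of_le (hyre t ht')] at h1
  · rintro ⟨n, rfl⟩
    rw [(hμ n).secular_eq_zero_iff hc hs fun t ht => hre n t ht.1, secular_zero_iff]
    exact ⟨r n, hr0 n, hμ0 n⟩

end RobinAiry

namespace RobinAiry

open Complex

/-! ### Eigenvalue sequences -/

/-- The reindexing between the two sequences is a monotone bijection of `ℕ`, hence the identity. -/
theorem IsEigenvalueSequence.eq_of_strictMono {T : L2 →ₗ.[ℂ] L2} {lam lam' : ℕ → ℂ}
    (h : IsEigenvalueSequence T lam) (h' : IsEigenvalueSequence T lam')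
    (hmono : StrictMono fun n => (lam n).re) : lam' = lam := by
  have hex : ∀ n, ∃ m, lam m = lam' n := fun n => by
    have : lam' n ∈ range lam' := mem_range_self n
    rwa [h'.range_eq, ← h.range_eq] at this
  choose σ hσ using hex
  have hinj : Function.Injective σ := fun n m hnm => h'.injective (by rw [← hσ, ← hσ, hnm])
  have hσm : Monotone σ := fun n m hnm => hmono.le_iff_le.1 (by
    have := h'.re_monotone hnm
    simpa only [hσ] using this)
  have hsurj : range σ = range (id : ℕ → ℕ) := by
    rw [range_id, eq_univ_iff_forall]
    intro m
    have : lam m ∈ range lam := mem_range_self m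
    rw [h.range_eq, ← h'.range_eq] at this
    obtain ⟨n, hn⟩ := this
    exact ⟨n, h.injective (by rw [hσ, hn])⟩
  have hid := ((hσm.strictMono_of_injective hinj).range_inj strictMono_id).1 hsurj
  ext1 n
  rw [← hσ n, hid, id]

/-! ### Growth of the curves, and the limit and monotonicity after rescaling -/

theorem norm_le_of_hasDerivAt {y : ℝ → ℂ}
    (hy : ∀ s, 0 ≤ s → HasDerivAt y (I / (y s + (s : ℂ) ^ 2)) s)
    (hre : ∀ s, 0 ≤ s → 19 / 40 ≤ (y s).re) {s : ℝ} (hs : 0 ≤ s) :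
    ‖y s‖ ≤ ‖y 0‖ + 40 / 19 * s := by
  have h := norm_image_sub_le_of_norm_deriv_right_le_segment (f := y) (a := 0) (b := s)
    (C := 40 / 19) (fun t ht => (hy t ht.1).continuousAt.continuousWithinAt)
    (fun t ht => (hy t ht.1).hasDerivWithinAt) (fun t ht => ?_) s ⟨hs, le_rfl⟩
  · have h2 := norm_sub_norm_le (y s) (y 0)
    rw [sub_zero] at h
    linarith
  · have h1 : 19 / 40 ≤ ‖y t + (t : ℂ) ^ 2‖ := by
      refine le_trans ?_ (re_le_norm _)
      rw [← ofReal_pow, add_re, ofReal_re]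
      linarith [hre t ht.1, sq_nonneg t]
    rw [norm_div, norm_I, div_le_iff₀ (by linarith)]
    linarith

theorem tendsto_sq_mul_curve {y : ℝ → ℂ}
    (hy : ∀ s, 0 ≤ s → HasDerivAt y (I / (y s + (s : ℂ) ^ 2)) s)
    (hre : ∀ s, 0 ≤ s → 19 / 40 ≤ (y s).re) {κ : ℝ} (hκ : 0 ≤ κ) :
    Tendsto (fun τ : ℝ => (τ : ℂ) ^ 2 * y (κ / τ)) (𝓝[>] 0) (𝓝 0) := by
  refine squeeze_zero_norm' (a := fun τ => τ ^ 2 * ‖y 0‖ + 40 / 19 * κ * τ) ?_ ?_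
  · filter_upwards [self_mem_nhdsWithin] with τ hτ
    have hτ : 0 < τ := hτ
    have h := norm_le_of_hasDerivAt hy hre (div_nonneg hκ hτ.le)
    rw [norm_mul, norm_pow, norm_real, Real.norm_of_nonneg hτ.le]
    calc τ ^ 2 * ‖y (κ / τ)‖ ≤ τ ^ 2 * (‖y 0‖ + 40 / 19 * (κ / τ)) := by gcongr
      _ = _ := by field_simp
  · have : Continuous fun τ : ℝ => τ ^ 2 * ‖y 0‖ + 40 / 19 * κ * τ := by fun_prop
    exact (this.tendsto' 0 0 (by simp)).mono_left nhdsWithin_le_nhds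

/-- Since `a ≥ 1/4`, `s ≤ a + s² = Re w`; then `2 Re w Im w ≤ |w|²` bounds the left side by `1/2`,
which is below `19/20 ≤ 2a`. -/
theorem mul_im_div_normSq_lt {w : ℂ} {a s : ℝ} (ha : 19 / 40 ≤ a)
    (hw : w.re = a + s ^ 2) (hi : 0 < w.im) : s * (w.im / normSq w) < 2 * a := by
  have hn : 0 < normSq w := by
    rw [normSq_apply]
    exact add_pos_of_nonneg_of_pos (mul_self_nonneg _) (mul_pos hi hi)
  rw [← mul_div_assoc, div_lt_iff₀ hn, normSq_apply, hw]
  have h1 : s ≤ a + s ^ 2 := by nlinarith [sq_nonneg (s - 1 / 2), sq_nonneg (s - 3 / 4)]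
  have h2 : s * w.im ≤ (a + s ^ 2) * w.im := by gcongr
  have h3 : 2 * ((a + s ^ 2) * w.im) ≤ (a + s ^ 2) * (a + s ^ 2) + w.im * w.im := by
    nlinarith [sq_nonneg (a + s ^ 2 - w.im)]
  have h4 : 0 < (a + s ^ 2) * w.im := by positivity
  nlinarith

theorem strictMonoOn_sq_mul_curve {y : ℝ → ℂ}
    (hy : ∀ s, 0 ≤ s → HasDerivAt y (I / (y s + (s : ℂ) ^ 2)) s)
    (hre : ∀ s, 0 ≤ s → 19 / 40 ≤ (y s).re ∧ 0 < (y s).im) {κ : ℝ} (hκ : 0 ≤ κ) :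
    StrictMonoOn (fun τ : ℝ => τ ^ 2 * (y (κ / τ)).re) (Ioi 0) := by
  have hd : ∀ τ : ℝ, 0 < τ → HasDerivAt (fun τ : ℝ => τ ^ 2 * (y (κ / τ)).re)
      (τ * (2 * (y (κ / τ)).re - κ / τ * ((y (κ / τ)).im /
        normSq (y (κ / τ) + ((κ / τ : ℝ) : ℂ) ^ 2)))) τ := by
    intro τ hτ
    have h1 : HasDerivAt (fun s => (y s).re) _ (κ / τ) :=
      reCLM.hasFDerivAt.comp_hasDerivAt _ (hy (κ / τ) (div_nonneg hκ hτ.le))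
    have h2 : HasDerivAt (fun τ => κ / τ) (-κ / τ ^ 2) τ := by
      simpa [div_eq_mul_inv] using (hasDerivAt_inv hτ.ne').const_mul κ
    have h3 := ((hasDerivAt_id τ).pow 2).mul (h1.comp τ h2)
    refine h3.congr_deriv ?_
    rw [reCLM_apply, I_div_re]
    simp only [add_im, ← ofReal_pow, ofReal_im, add_zero, Function.comp, id, Pi.pow_apply]
    field_simp
    ring
  refine strictMonoOn_of_deriv_pos (convex_Ioi 0)
    (fun τ hτ => (hd τ hτ).continuousAt.continuousWithinAt) fun τ hτ => ?_
  rw [interior_Ioi] at hτ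
  have hτ : 0 < τ := hτ
  have hs : 0 ≤ κ / τ := div_nonneg hκ hτ.le
  obtain ⟨h1, h2⟩ := hre (κ / τ) hs
  rw [(hd τ hτ).deriv]
  refine mul_pos hτ (sub_pos.2 ?_)
  have e : (y (κ / τ) + ((κ / τ : ℝ) : ℂ) ^ 2).im = (y (κ / τ)).im := by
    rw [← ofReal_pow, add_im, ofReal_im, add_zero]
  have h3 := mul_im_div_normSq_lt (w := y (κ / τ) + ((κ / τ : ℝ) : ℂ) ^ 2) h1
    (by rw [← ofReal_pow, add_re, ofReal_re]) (by rwa [e])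
  rwa [e] at h3

/-- The eigenvalues of the Robin complex Airy operator in terms of universal curves. -/
theorem exists_isEigenvalueSequence_curves {κ : ℝ} (hκ : 0 ≤ κ) :
    ∃ μ : ℕ → ℝ → ℂ,
      (∀ n s, 0 ≤ s → HasDerivAt (μ n) (I / (μ n s + (s : ℂ) ^ 2)) s) ∧
      (∀ n s, 0 ≤ s → 19 / 40 ≤ (μ n s).re ∧ 0 < (μ n s).im) ∧
      ∀ τ : ℝ, 0 < τ →
        (StrictMono fun n => ((τ : ℂ) ^ 2 * μ n (κ / τ)).re) ∧
        IsEigenvalueSequence (robinAiry (τ ^ 3) κ) fun n => (τ : ℂ) ^ 2 * μ n (κ / τ) := by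
  obtain ⟨μ, h1, h2, h3, h4⟩ := exists_eigenvalue_curves
  refine ⟨μ, h1, h2, fun τ hτ => ?_⟩
  have hs : 0 ≤ κ / τ := div_nonneg hκ hτ.le
  have hτ' : (τ : ℂ) ^ 2 ≠ 0 := pow_ne_zero 2 (ofReal_ne_zero.2 hτ.ne')
  have hmono : StrictMono fun n => ((τ : ℂ) ^ 2 * μ n (κ / τ)).re := fun n m hnm => by
    simp only [← ofReal_pow, re_ofReal_mul]
    exact mul_lt_mul_of_pos_left (h3 _ hs hnm) (by positivity)
  refine ⟨hmono, fun n m hnm => hmono.injective (congrArg re hnm), ?_, hmono.monotone⟩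
  ext z
  rw [mem_ofPred_eq, isEigenvalue_robinAiry_iff hτ, h4 _ hs]
  refine exists_congr fun n => ?_
  rw [eq_div_iff hτ', mul_comm]

end RobinAiry

/-- For `κ ≥ 0`: for every `j > 0` the eigenvalues of the Robin complex Airy operator form a
sequence, uniquely ordered by nondecreasing real part; each term of it extends to `j = 0` by
continuity, with the value `0`; and the real part of the extended function is strictly increasing
on `[0, ∞)`. -/
theorem propositionC1 (κ : ℝ) (hκ : 0 ≤ κ) :
    (∀ j : ℝ, 0 < j →
      ∃! μ : ℕ → ℂ, RobinAiry.IsEigenvalueSequence (RobinAiry.robinAiry j κ) μ) ∧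
    ∀ lam : ℝ → ℕ → ℂ,
      (∀ j : ℝ, 0 < j →
        RobinAiry.IsEigenvalueSequence (RobinAiry.robinAiry j κ) (lam j)) →
      ∀ n : ℕ,
        Tendsto (fun j : ℝ => lam j n) (𝓝[>] 0) (𝓝 0) ∧
        StrictMonoOn (Function.update (fun j : ℝ => (lam j n).re) 0 0) (Ici 0) := by
  obtain ⟨μ, hd, hpos, hseq⟩ := RobinAiry.exists_isEigenvalueSequence_curves hκ
  have hroot : ∀ j : ℝ, 0 < j → 0 < j ^ (1 / 3 : ℝ) ∧ (j ^ (1 / 3 : ℝ)) ^ 3 = j := fun j hj => by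
    refine ⟨Real.rpow_pos_of_pos hj _, ?_⟩
    rw [← Real.rpow_natCast, ← Real.rpow_mul hj.le]
    norm_num
  refine ⟨fun j hj => ?_, fun lam hlam n => ?_⟩
  · obtain ⟨hτ, hτ3⟩ := hroot j hj
    obtain ⟨hm, hs⟩ := hseq _ hτ
    rw [hτ3] at hs
    exact ⟨_, hs, fun ν hν => hs.eq_of_strictMono hν hm⟩
  · have hlam' : ∀ j : ℝ, 0 < j →
        lam j n = ((j ^ (1 / 3 : ℝ) : ℝ) : ℂ) ^ 2 * μ n (κ / j ^ (1 / 3 : ℝ)) := fun j hj => by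
      obtain ⟨hτ, hτ3⟩ := hroot j hj
      obtain ⟨hm, hs⟩ := hseq _ hτ
      rw [hτ3] at hs
      exact congrFun (hs.eq_of_strictMono (hlam j hj) hm) n
    have hre : ∀ j : ℝ, 0 < j →
        (lam j n).re = (j ^ (1 / 3 : ℝ)) ^ 2 * (μ n (κ / j ^ (1 / 3 : ℝ))).re := fun j hj => by
      rw [hlam' j hj, ← Complex.ofReal_pow, Complex.re_ofReal_mul]
    constructor
    · have hroot0 : Tendsto (fun j : ℝ => j ^ (1 / 3 : ℝ)) (𝓝[>] 0) (𝓝[>] 0) := by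
        refine tendsto_nhdsWithin_iff.2 ⟨?_, ?_⟩
        · have := (Real.continuous_rpow_const (q := 1 / 3) (by norm_num)).tendsto' 0 0 (by simp)
          exact this.mono_left nhdsWithin_le_nhds
        · filter_upwards [self_mem_nhdsWithin] with j hj using (hroot j hj).1
      refine ((RobinAiry.tendsto_sq_mul_curve (hd n) (fun s hs => (hpos n s hs).1) hκ).comp hroot0).congr' ?_
      filter_upwards [self_mem_nhdsWithin] with j hj using (hlam' j hj).symm
    · intro a ha b hb hab
      have hb0 : 0 < b := lt_of_le_of_lt ha hab
      rw [Function.update_of_ne hb0.ne', hre b hb0]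
      obtain ⟨hτb, -⟩ := hroot b hb0
      -- At the endpoint the extended value is `0`, so positivity of the real part suffices there.
      rcases eq_or_lt_of_le (show 0 ≤ a from ha) with rfl | ha0
      · rw [Function.update_self]
        have := (hpos n (κ / b ^ (1 / 3 : ℝ)) (div_nonneg hκ hτb.le)).1
        positivity
      · rw [Function.update_of_ne ha0.ne', hre a ha0]
        exact RobinAiry.strictMonoOn_sq_mul_curve (hd n) (hpos n) hκ (hroot a ha0).1 hτb
          (Real.rpow_lt_rpow ha0.le hab (by norm_num))
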